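/- Let $p$ be an odd prime and let $m\ge 2$, $n\ge 1$ and $1\le r\le\min\{n,m-1\}$ be integers. Let \[ G=\langle x,y : x^{p^m}=1,\ y^{p^n}=1,\ yxy^{-1}=x^{1+p^{m-r}}\rangle . \] Let $u$ be an integer generating the group of units modulo $p^m$, and let $\alpha,\beta,\delta\in\mathrm{Aut}(G)$ be the automorphisms given by \[ \alpha(x)=x^u,\ \alpha(y)=y;\qquad \beta(x)=x,\ \beta(y)=x^{p^{\max\{m-n,0\}}}y;\qquad \delta(x)=x,\ \delta(y)=y^{1+p^r}. \] Put \[ \widetilde\alpha=\alpha^{(p-1)p^{m-r-1}},\quad \widetilde\beta=\beta^{p^{\min\{m,n\}-r}},\quad \widetilde\delta=\delta^{p^{\max\{n-2r,0\}}},\quad \widetilde u=u^{(p-1)p^{m-r-1}},\quad \widetilde v=(1+p^r)^{p^{\max\{n-2r,0\}}}. \] A triplet $(a,b,d)\in\mathbb{Z}^3$ is called admissible if the assignments \[ \Gamma(x)=\widetilde\beta^{\,b},\qquad \Gamma(y)=\widetilde\alpha^{\,a}\widetilde\delta^{\,d} \] extend to a map $\Gamma:G\to\mathrm{Aut}(G)$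 with $\Gamma(\sigma\tau)=\Gamma(\tau)\Gamma(\sigma)$ and $\Gamma(\varphi(\sigma))=\varphi\,\Gamma(\sigma)\,\varphi^{-1}$ for all $\sigma,\tau\in G$ and $\varphi\in\mathrm{Aut}(G)$. Negative powers of integers coprime to $p$ in congruences modulo a power of $p$ are powers of the inverse residue class. Then, for all $a,b,d\in\mathbb{Z}$: 1. If $m\le n$, then $(a,b,d)$ is admissible if and only if \[ \widetilde u^{-a}\,\widetilde v^{\,d}\equiv 1+bp^{m-r}\pmod{p^m}\quad\text{and}\quad b\equiv 0\text{ or }1\pmod{p^{\max\{2r-m,0\}}}. \] 2. If $n\le m-r$, then $(a,b,d)$ is admissible if and only if \[ \widetilde u^{\,a}(1+bp^{m-r})\equiv 1\pmod{p^m}\quad\text{and}\quad \widetilde v^{\,d}\equiv 1\pmod{p^n}. \] -/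

import Mathlib

namespace SplitMetacyclic

/-- The standing assumptions on the parameters: `p` is an odd prime, `m ≥ 2`, `n ≥ 1` and
`1 ≤ r ≤ min {n, m - 1}`. -/
structure Params (p m n r : ℕ) : Prop where
  prime : p.Prime
  odd : p ≠ 2
  two_le_m : 2 ≤ m
  one_le_n : 1 ≤ n
  one_le_r : 1 ≤ r
  r_le : r ≤ min n (m - 1)

/-- The relators of `⟨x, y : x^(p^m) = 1, y^(p^n) = 1, y x y⁻¹ = x^(1 + p^(m-r))⟩`, where the
free generators `0` and `1` stand for `x` and `y`. -/
def rels (p m n r : ℕ) : Set (FreeGroup (Fin 2)) :=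
  {FreeGroup.of 0 ^ (p ^ m), FreeGroup.of 1 ^ (p ^ n),
    FreeGroup.of 1 * FreeGroup.of 0 * (FreeGroup.of 1)⁻¹ *
      (FreeGroup.of 0 ^ (1 + p ^ (m - r)))⁻¹}

/-- The split metacyclic `p`-group
`G = ⟨x, y : x^(p^m) = 1, y^(p^n) = 1, y x y⁻¹ = x^(1 + p^(m-r))⟩`. -/
abbrev Grp (p m n r : ℕ) : Type := PresentedGroup (rels p m n r)

/-- The generator `x` of `G`. -/
def genX (p m n r : ℕ) : Grp p m n r := PresentedGroup.of 0

/-- The generator `y` of `G`. -/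
def genY (p m n r : ℕ) : Grp p m n r := PresentedGroup.of 1

section Relations

variable {p m n r : ℕ}

theorem genX_pow : genX p m n r ^ (p ^ m) = 1 :=
  PresentedGroup.one_of_mem (rels := rels p m n r) (x := FreeGroup.of 0 ^ (p ^ m))
    (by simp [rels])

theorem genY_pow : genY p m n r ^ (p ^ n) = 1 :=
  PresentedGroup.one_of_mem (rels := rels p m n r) (x := FreeGroup.of 1 ^ (p ^ n))
    (by simp [rels])

theorem genY_conj :
    genY p m n r * genX p m n r * (genY p m n r)⁻¹ = genX p m n r ^ (1 + p ^ (m - r)) := by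
  have h := PresentedGroup.one_of_mem (rels := rels p m n r)
    (x := FreeGroup.of 1 * FreeGroup.of 0 * (FreeGroup.of 1)⁻¹ *
      (FreeGroup.of 0 ^ (1 + p ^ (m - r)))⁻¹) (by simp [rels])
  exact mul_inv_eq_one.mp h

/-- The homomorphism `G → H` with `x ↦ X` and `y ↦ Y`, for `X`, `Y` satisfying the relations. -/
def lift {H : Type*} [Group H] (X Y : H) (hX : X ^ (p ^ m) = 1) (hY : Y ^ (p ^ n) = 1)
    (hXY : Y * X * Y⁻¹ = X ^ (1 + p ^ (m - r))) : Grp p m n r →* H :=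
  PresentedGroup.toGroup (f := ![X, Y]) (by
    intro w hw
    simp only [rels, Set.mem_insert_iff, Set.mem_singleton_iff] at hw
    rcases hw with rfl | rfl | rfl
    · simpa using hX
    · simpa using hY
    · simpa using mul_inv_eq_one.mpr hXY)

section
variable {H : Type*} [Group H] {X Y : H} (hX : X ^ (p ^ m) = 1) (hY : Y ^ (p ^ n) = 1)
  (hXY : Y * X * Y⁻¹ = X ^ (1 + p ^ (m - r)))

theorem lift_x : lift X Y hX hY hXY (genX p m n r) = X := by
  simp [lift, genX]

theorem lift_y : lift X Y hX hY hXY (genY p m n r) = Y := by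
  simp [lift, genY]

end

theorem hom_ext {H : Type*} [Group H] {f g : Grp p m n r →* H}
    (hx : f (genX p m n r) = g (genX p m n r)) (hy : f (genY p m n r) = g (genY p m n r)) :
    f = g := by
  apply PresentedGroup.ext
  intro i
  fin_cases i
  · exact hx
  · exact hy

theorem genX_zpow_eq_one {t : ℤ} (h : ((p ^ m : ℕ) : ℤ) ∣ t) : genX p m n r ^ t = 1 := by
  obtain ⟨c, rfl⟩ := h
  rw [zpow_mul, zpow_natCast, genX_pow, one_zpow]

theorem genY_zpow_eq_one {t : ℤ} (h : ((p ^ n : ℕ) : ℤ) ∣ t) : genY p m n r ^ t = 1 := by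
  obtain ⟨c, rfl⟩ := h
  rw [zpow_mul, zpow_natCast, genY_pow, one_zpow]

theorem genY_mul_genX_zpow (k : ℤ) :
    genY p m n r * genX p m n r ^ k =
      genX p m n r ^ ((1 + (p : ℤ) ^ (m - r)) * k) * genY p m n r := by
  have h : (genY p m n r * genX p m n r * (genY p m n r)⁻¹) ^ k =
      (genX p m n r ^ (1 + p ^ (m - r))) ^ k := by rw [genY_conj]
  rw [conj_zpow, ← zpow_natCast, ← zpow_mul] at h
  push_cast at h
  rw [← h]
  group

theorem genY_pow_mul_genX_zpow (l : ℕ) (k : ℤ) :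
    genY p m n r ^ l * genX p m n r ^ k =
      genX p m n r ^ ((1 + (p : ℤ) ^ (m - r)) ^ l * k) * genY p m n r ^ l := by
  induction l with
  | zero => simp
  | succ l ih =>
    rw [pow_succ', mul_assoc, ih, ← mul_assoc, genY_mul_genX_zpow, mul_assoc,
      ← pow_succ', pow_succ' (1 + (p : ℤ) ^ (m - r)), mul_assoc]

theorem mul_pow_eq (k : ℤ) (l : ℕ) :
    (genX p m n r ^ k * genY p m n r) ^ l =
      genX p m n r ^ (k * ∑ i ∈ Finset.range l, (1 + (p : ℤ) ^ (m - r)) ^ i) *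
        genY p m n r ^ l := by
  induction l with
  | zero => simp
  | succ l ih =>
    rw [pow_succ, ih, mul_assoc, ← mul_assoc (genY p m n r ^ l), genY_pow_mul_genX_zpow,
      mul_assoc, ← mul_assoc, ← zpow_add, ← pow_succ, Finset.sum_range_succ]
    congr 2
    ring

theorem pow_dvd_geom_sum {w : ℤ} (hw : (p : ℤ) ∣ w - 1) (hw1 : w ≠ 1) (k : ℕ) :
    (p : ℤ) ^ k ∣ ∑ i ∈ Finset.range (p ^ k), w ^ i := by
  induction k with
  | zero => simp
  | succ k ih =>
    have h1 : (w - 1) * ∑ i ∈ Finset.range (p ^ (k + 1)), w ^ i =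
        (w - 1) * ((∑ i ∈ Finset.range (p ^ k), w ^ i) *
          ∑ j ∈ Finset.range p, (w ^ p ^ k) ^ j) := by
      rw [mul_geom_sum, ← mul_assoc, mul_geom_sum, mul_geom_sum, ← pow_mul, ← pow_succ]
    rw [mul_left_cancel₀ (sub_ne_zero.mpr hw1) h1, pow_succ]
    refine mul_dvd_mul ih ?_
    have h2 : ∀ j ∈ Finset.range p, (w ^ p ^ k) ^ j ≡ 1 [ZMOD p] := by
      intro j _
      have h3 : w ≡ 1 [ZMOD p] := (Int.modEq_iff_dvd.mpr hw).symm
      simpa using (h3.pow (p ^ k)).pow j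
    have h4 : ∑ j ∈ Finset.range p, (w ^ p ^ k) ^ j ≡ ∑ j ∈ Finset.range p, 1 [ZMOD p] :=
      Int.ModEq.sum h2
    simp only [Finset.sum_const, Finset.card_range, nsmul_eq_mul, mul_one] at h4
    exact (Int.modEq_zero_iff_dvd).mp (h4.trans (by simp [Int.ModEq]))

theorem Params.r_lt_m (h : Params p m n r) : r < m := by
  have := h.r_le; have := h.two_le_m; omega

theorem Params.r_le_n (h : Params p m n r) : r ≤ n := by
  have := h.r_le; omega

theorem Params.geom_sum (h : Params p m n r) (k : ℕ) :
    (p : ℤ) ^ k ∣ ∑ i ∈ Finset.range (p ^ k), (1 + (p : ℤ) ^ (m - r)) ^ i := by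
  apply pow_dvd_geom_sum
  · have := h.r_lt_m
    simpa using dvd_pow_self (p : ℤ) (show m - r ≠ 0 by omega)
  · have : (p : ℤ) ^ (m - r) ≠ 0 := pow_ne_zero _ (by exact_mod_cast h.prime.ne_zero)
    simpa using this

theorem Params.genY_pow_commute (h : Params p m n r) :
    Commute (genY p m n r ^ (p ^ r)) (genX p m n r) := by
  have h1 := genY_pow_mul_genX_zpow (p := p) (m := m) (n := n) (r := r) (p ^ r) 1
  have h2 : ((p ^ m : ℕ) : ℤ) ∣ (1 + (p : ℤ) ^ (m - r)) ^ (p ^ r) - 1 := by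
    rw [← mul_geom_sum, add_sub_cancel_left, Nat.cast_pow,
      ← Nat.sub_add_cancel h.r_lt_m.le, pow_add, Nat.sub_add_cancel h.r_lt_m.le]
    exact mul_dvd_mul_left _ (h.geom_sum r)
  have h3 : genX p m n r ^ ((1 + (p : ℤ) ^ (m - r)) ^ (p ^ r) * 1) = genX p m n r := by
    have := genX_zpow_eq_one (n := n) (r := r) h2
    rw [zpow_sub, zpow_one, mul_inv_eq_one] at this
    rw [mul_one, this]
  rw [h3, zpow_one] at h1
  exact h1

end Relations

section Automorphisms

variable {p m n r : ℕ}

/-- The endomorphism `x ↦ x^e`, `y ↦ y`. -/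
def alphaHom (p m n r : ℕ) (e : ℤ) : Grp p m n r →* Grp p m n r :=
  lift (genX p m n r ^ e) (genY p m n r)
    (by rw [← zpow_natCast, ← zpow_mul]; exact genX_zpow_eq_one (Dvd.intro_left _ rfl))
    genY_pow
    (by
      rw [genY_mul_genX_zpow, mul_inv_cancel_right, ← zpow_natCast, ← zpow_mul]
      congr 1; push_cast; ring)

theorem alphaHom_comp {e f : ℤ} (h : ((p ^ m : ℕ) : ℤ) ∣ f * e - 1) :
    (alphaHom p m n r e).comp (alphaHom p m n r f) = MonoidHom.id _ := by
  apply hom_ext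
  · have := genX_zpow_eq_one (n := n) (r := r) h
    rw [zpow_sub, zpow_one, mul_inv_eq_one] at this
    simp only [alphaHom, MonoidHom.comp_apply, lift_x, map_zpow, MonoidHom.id_apply]
    rw [← zpow_mul, mul_comm, this]
  · simp [alphaHom, lift_y]

theorem dvd_choose {u N : ℤ} (h : IsCoprime u N) : N ∣ h.choose * u - 1 := by
  obtain ⟨b, hb⟩ := h.choose_spec
  exact ⟨-b, by linear_combination hb⟩

/-- The automorphism `α` of `G` with `α(x) = x^u` and `α(y) = y`, for `u` coprime to `p^m`. -/
noncomputable def alpha (p m n r : ℕ) (u : ℤ) (hu : IsCoprime u ((p ^ m : ℕ) : ℤ)) :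
    MulAut (Grp p m n r) :=
  MonoidHom.toMulEquiv (alphaHom p m n r u) (alphaHom p m n r hu.choose)
    (alphaHom_comp (by rw [mul_comm]; exact dvd_choose hu))
    (alphaHom_comp (dvd_choose hu))

theorem alpha_x (u : ℤ) (hu : IsCoprime u ((p ^ m : ℕ) : ℤ)) :
    alpha p m n r u hu (genX p m n r) = genX p m n r ^ u := by
  change alphaHom p m n r u (genX p m n r) = _
  rw [alphaHom, lift_x]

theorem alpha_y (u : ℤ) (hu : IsCoprime u ((p ^ m : ℕ) : ℤ)) :
    alpha p m n r u hu (genY p m n r) = genY p m n r := by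
  change alphaHom p m n r u (genY p m n r) = _
  rw [alphaHom, lift_y]

/-- The endomorphism `x ↦ x`, `y ↦ x^k y`. -/
def betaHom (h : Params p m n r) (k : ℤ) (hk : ((p ^ m : ℕ) : ℤ) ∣ k * (p : ℤ) ^ n) :
    Grp p m n r →* Grp p m n r :=
  lift (genX p m n r) (genX p m n r ^ k * genY p m n r) genX_pow
    (by
      rw [mul_pow_eq, genY_pow, mul_one]
      exact genX_zpow_eq_one (hk.trans (mul_dvd_mul_left _ (h.geom_sum n))))
    (by
      rw [← genY_conj (p := p) (m := m) (n := n) (r := r)]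
      have h1 : genX p m n r ^ k * (genY p m n r * genX p m n r * (genY p m n r)⁻¹) =
          (genY p m n r * genX p m n r * (genY p m n r)⁻¹) * genX p m n r ^ k := by
        rw [genY_conj]
        exact ((Commute.refl (genX p m n r)).zpow_left k).pow_right _
      calc genX p m n r ^ k * genY p m n r * genX p m n r *
            (genX p m n r ^ k * genY p m n r)⁻¹
          = genX p m n r ^ k * (genY p m n r * genX p m n r * (genY p m n r)⁻¹) *
              (genX p m n r ^ k)⁻¹ := by group
        _ = _ := by rw [h1, mul_inv_cancel_right])

theorem betaHom_comp (h : Params p m n r) (k l : ℤ) (hk : ((p ^ m : ℕ) : ℤ) ∣ k * (p : ℤ) ^ n)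
    (hl : ((p ^ m : ℕ) : ℤ) ∣ l * (p : ℤ) ^ n) (hkl : l + k = 0) :
    (betaHom h k hk).comp (betaHom h l hl) = MonoidHom.id _ := by
  apply hom_ext
  · simp [betaHom, lift_x]
  · simp only [betaHom, MonoidHom.comp_apply, lift_x, lift_y, map_zpow, map_mul,
      MonoidHom.id_apply]
    rw [← mul_assoc, ← zpow_add, hkl, zpow_zero, one_mul]

theorem beta_dvd : ((p ^ m : ℕ) : ℤ) ∣ ((p ^ (m - n) : ℕ) : ℤ) * (p : ℤ) ^ n := by
  push_cast
  rw [← pow_add]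
  exact pow_dvd_pow _ (by omega)

/-- The automorphism `β` of `G` with `β(x) = x` and `β(y) = x^(p^max{m-n,0}) y`
(the truncated subtraction `m - n` is `max{m-n,0}`). -/
def beta (h : Params p m n r) : MulAut (Grp p m n r) :=
  MonoidHom.toMulEquiv (betaHom h ((p ^ (m - n) : ℕ) : ℤ) beta_dvd)
    (betaHom h (-((p ^ (m - n) : ℕ) : ℤ)) (by rw [neg_mul]; exact (dvd_neg).mpr beta_dvd))
    (betaHom_comp h _ _ _ _ (by ring))
    (betaHom_comp h _ _ _ _ (by ring))

theorem beta_x (h : Params p m n r) : beta h (genX p m n r) = genX p m n r := by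
  change betaHom h ((p ^ (m - n) : ℕ) : ℤ) beta_dvd (genX p m n r) = _
  rw [betaHom, lift_x]

theorem beta_y (h : Params p m n r) :
    beta h (genY p m n r) = genX p m n r ^ (p ^ (m - n)) * genY p m n r := by
  rw [← zpow_natCast]
  change betaHom h ((p ^ (m - n) : ℕ) : ℤ) beta_dvd (genY p m n r) = _
  rw [betaHom, lift_y]

/-- The endomorphism `x ↦ x`, `y ↦ y^e`, for `e ≡ 1 (mod p^r)`. -/
def deltaHom (h : Params p m n r) (e : ℤ) (he : ((p ^ r : ℕ) : ℤ) ∣ e - 1) :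
    Grp p m n r →* Grp p m n r :=
  lift (genX p m n r) (genY p m n r ^ e) genX_pow
    (by rw [← zpow_natCast, ← zpow_mul]; exact genY_zpow_eq_one (Dvd.intro_left _ rfl))
    (by
      obtain ⟨c, hc⟩ := he
      obtain rfl : e = 1 + ((p ^ r : ℕ) : ℤ) * c := by linear_combination hc
      have h1 : genY p m n r ^ (((p ^ r : ℕ) : ℤ) * c) * genX p m n r =
          genX p m n r * genY p m n r ^ (((p ^ r : ℕ) : ℤ) * c) := by
        rw [zpow_mul, zpow_natCast]
        exact h.genY_pow_commute.zpow_left c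
      rw [← genY_conj (p := p) (m := m) (n := n) (r := r), zpow_add, zpow_one,
        mul_assoc (genY p m n r), h1]
      group)

theorem deltaHom_comp (h : Params p m n r) {e f : ℤ} (he : ((p ^ r : ℕ) : ℤ) ∣ e - 1)
    (hf : ((p ^ r : ℕ) : ℤ) ∣ f - 1) (hef : ((p ^ n : ℕ) : ℤ) ∣ f * e - 1) :
    (deltaHom h e he).comp (deltaHom h f hf) = MonoidHom.id _ := by
  apply hom_ext
  · simp [deltaHom, lift_x]
  · have := genY_zpow_eq_one (m := m) (r := r) hef
    rw [zpow_sub, zpow_one, mul_inv_eq_one] at this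
    simp only [deltaHom, MonoidHom.comp_apply, lift_y, map_zpow, MonoidHom.id_apply]
    rw [← zpow_mul, mul_comm, this]

theorem Params.coprime (h : Params p m n r) (k : ℕ) :
    IsCoprime (1 + (p : ℤ) ^ r) ((p ^ k : ℕ) : ℤ) := by
  push_cast
  apply IsCoprime.pow_right
  obtain ⟨s, rfl⟩ := Nat.exists_eq_add_of_le' h.one_le_r
  exact ⟨1, -(p : ℤ) ^ s, by ring⟩

theorem Params.choose_dvd (h : Params p m n r) :
    ((p ^ r : ℕ) : ℤ) ∣ (h.coprime n).choose - 1 := by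
  have h1 : ((p ^ r : ℕ) : ℤ) ∣ (h.coprime n).choose * (1 + (p : ℤ) ^ r) - 1 :=
    dvd_trans (by push_cast; exact pow_dvd_pow _ h.r_le_n) (dvd_choose (h.coprime n))
  have h2 : ((p ^ r : ℕ) : ℤ) ∣ (h.coprime n).choose * (p : ℤ) ^ r := by
    push_cast
    exact Dvd.intro_left _ rfl
  have h3 := dvd_sub h1 h2
  have h4 : (h.coprime n).choose * (1 + (p : ℤ) ^ r) - 1 - (h.coprime n).choose * (p : ℤ) ^ r =
      (h.coprime n).choose - 1 := by ring
  rwa [h4] at h3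

/-- The automorphism `δ` of `G` with `δ(x) = x` and `δ(y) = y^(1 + p^r)`. -/
noncomputable def delta (h : Params p m n r) : MulAut (Grp p m n r) :=
  MonoidHom.toMulEquiv (deltaHom h (1 + (p : ℤ) ^ r) (by simp))
    (deltaHom h (h.coprime n).choose h.choose_dvd)
    (deltaHom_comp h _ _ (by rw [mul_comm]; exact dvd_choose (h.coprime n)))
    (deltaHom_comp h _ _ (dvd_choose (h.coprime n)))

theorem delta_x (h : Params p m n r) : delta h (genX p m n r) = genX p m n r := by
  change deltaHom h (1 + (p : ℤ) ^ r) (by simp) (genX p m n r) = _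
  rw [deltaHom, lift_x]

theorem delta_y (h : Params p m n r) :
    delta h (genY p m n r) = genY p m n r ^ (1 + p ^ r) := by
  rw [← zpow_natCast]
  push_cast
  change deltaHom h (1 + (p : ℤ) ^ r) (by simp) (genY p m n r) = _
  rw [deltaHom, lift_y]

end Automorphisms

section Admissible

variable {p m n r : ℕ}

/-- `α̃ = α^((p-1) p^(m-r-1))`. -/
noncomputable def alphaTilde (p m n r : ℕ) (u : ℤ) (hu : IsCoprime u ((p ^ m : ℕ) : ℤ)) :
    MulAut (Grp p m n r) :=
  alpha p m n r u hu ^ ((p - 1) * p ^ (m - r - 1))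

/-- `β̃ = β^(p^(min{m,n} - r))`. -/
def betaTilde (h : Params p m n r) : MulAut (Grp p m n r) :=
  beta h ^ (p ^ (min m n - r))

/-- `δ̃ = δ^(p^max{n-2r,0})` (the truncated subtraction `n - 2 * r` is `max{n-2r,0}`). -/
noncomputable def deltaTilde (h : Params p m n r) : MulAut (Grp p m n r) :=
  delta h ^ (p ^ (n - 2 * r))

/-- The integer `ũ = u^((p-1) p^(m-r-1))`. -/
def uTilde (p m r : ℕ) (u : ℤ) : ℤ := u ^ ((p - 1) * p ^ (m - r - 1))

/-- The integer `ṽ = (1 + p^r)^(p^max{n-2r,0})`. -/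
def vTilde (p n r : ℕ) : ℤ := (1 + (p : ℤ) ^ r) ^ (p ^ (n - 2 * r))

theorem uTilde_coprime {u : ℤ} (hu : IsCoprime u ((p ^ m : ℕ) : ℤ)) :
    IsCoprime (uTilde p m r u) ((p ^ m : ℕ) : ℤ) :=
  hu.pow_left

theorem vTilde_coprime (h : Params p m n r) (k : ℕ) :
    IsCoprime (vTilde p n r) ((p ^ k : ℕ) : ℤ) :=
  (h.coprime k).pow_left

/-- The residue class modulo `N` of the power `z^e` with an integer exponent `e`, possibly
negative, of an integer `z` coprime to `N`. -/
def powMod (N : ℕ) (z : ℤ) (hz : IsCoprime z (N : ℤ)) (e : ℤ) : ZMod N :=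
  ((ZMod.unitOfIsCoprime z hz ^ e : (ZMod N)ˣ) : ZMod N)

/-- `Γ(στ) = Γ(τ)Γ(σ)` for all `σ`, `τ`. -/
def IsAntihom {G H : Type*} [Group G] [Group H] (Γ : G → H) : Prop :=
  ∀ σ τ : G, Γ (σ * τ) = Γ τ * Γ σ

/-- `Γ(φ(σ)) = φ Γ(σ) φ⁻¹` for all `σ ∈ G` and `φ ∈ Aut(G)`. -/
def IsAutEquivariant {G : Type*} [Group G] (Γ : G → MulAut G) : Prop :=
  ∀ (φ : MulAut G) (σ : G), Γ (φ σ) = φ * Γ σ * φ⁻¹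

/-- `(a,b,d)` is admissible: the assignment `x ↦ β̃^b`, `y ↦ α̃^a δ̃^d` extends to an
antihomomorphism `Γ : G → Aut(G)` (such an extension is unique, since `x` and `y` generate `G`)
that is `Aut(G)`-equivariant. -/
def Admissible (h : Params p m n r) (u : ℤ) (hu : IsCoprime u ((p ^ m : ℕ) : ℤ))
    (a b d : ℤ) : Prop :=
  ∃ Γ : Grp p m n r → MulAut (Grp p m n r),
    Γ (genX p m n r) = betaTilde h ^ b ∧
    Γ (genY p m n r) = alphaTilde p m n r u hu ^ a * deltaTilde h ^ d ∧
    IsAntihom Γ ∧ IsAutEquivariant Γ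

end Admissible

end SplitMetacyclic

/-! Write q = p^(m-r), η = α̃^a δ̃^d, and let A, V be the exponents with η(x) = x^A and η(y) = y^V;
here V ≡ 1 mod p^r. The key observation is that β̃ is conjugation by x⁻¹ (`betaTilde_eq`), so Γ(x) =
conj(x)^(-b). Computations take place in the normal form x^i y^j, whose exponents are unique modulo
p^m and p^n (`exists_normal`, `normal_inj`).

Case m ≤ n. Equivariance under β, evaluated at y, forces A(1+bq) = V mod p^m. Compatibility of Γ
with y x y⁻¹ = x^(1+q) then forces b(b-1)q² = 0 mod p^m, that is, b ≡ 0 or 1 mod p^max{2r-m,0},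
because b and b-1 are coprime (`eq_of_equivariant_of_le`). Conversely, for such b one has (1+q)^b =
1+bq mod p^m, so η conj(y)^b is the power map g ↦ g^V (`mul_conj_pow_apply`). A power map commutes
with every automorphism φ, hence φηφ⁻¹ differs from η only through conj(φ(y))^(-b). The shape of φ
(`aut_form`) and η^(p^r) = 1 then give equivariance on the generators.

Case n ≤ m-r. Now Inn(G) is abelian and x ↦ xy, y ↦ y is an automorphism. Equivariance under it
forces η = conj(y)^(-b), which amounts to the two congruences. Conversely g ↦ conj(g)^(-b) is
equivariant, and is an antihomomorphism because Inn(G) is abelian. -/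

namespace SplitMetacyclic

/-! ### Geometric sums modulo powers of an odd prime -/

/-- For odd `p`, a geometric sum of `p^e N` terms with ratio `w ≡ 1 (mod p^c)` is congruent to
its number of terms modulo `p^(e+c)`. -/
theorem geom_sum_eq_add {p : ℕ} (hp : Odd p) {c : ℕ} (hc : 1 ≤ c) {w : ℤ}
    (hw : (p : ℤ) ^ c ∣ w - 1) (e N : ℕ) :
    ∃ z : ℤ, ∑ l ∈ Finset.range (p ^ e * N), w ^ l = (p : ℤ) ^ e * N + (p : ℤ) ^ (e + c) * z := by
  induction e with
  | zero =>
    have h1 : ∑ l ∈ Finset.range N, w ^ l ≡ ∑ l ∈ Finset.range N, (1 : ℤ) [ZMOD (p : ℤ) ^ c] := by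
      apply Int.ModEq.sum
      intro l _
      simpa using ((Int.modEq_iff_dvd.mpr hw).symm).pow l
    obtain ⟨z, hz⟩ := Int.modEq_iff_dvd.mp h1.symm
    refine ⟨z, ?_⟩
    simp only [Finset.sum_const, Finset.card_range, nsmul_eq_mul, mul_one] at hz
    simp only [pow_zero, one_mul, zero_add]
    linear_combination hz
  | succ e ih =>
    obtain ⟨z, hz⟩ := ih
    set M := p ^ e * N with hM
    set S := ∑ l ∈ Finset.range M, w ^ l with hS
    have hprod : ∑ l ∈ Finset.range (p ^ (e + 1) * N), w ^ l =
        S * ∑ i ∈ Finset.range p, (w ^ M) ^ i := by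
      have : p ^ (e + 1) * N = p * M := by rw [hM]; ring
      rw [this]
      generalize p = P
      induction P with
      | zero => simp
      | succ P ihP =>
        rw [add_mul, one_mul, Finset.sum_range_add, ihP, Finset.sum_range_succ, mul_add,
          add_right_inj, hS, Finset.sum_mul]
        refine Finset.sum_congr rfl fun l _ => ?_
        rw [pow_add, ← pow_mul, mul_comm, mul_comm P M]
    obtain ⟨t, ht⟩ : ∃ t, w ^ M = 1 + (p : ℤ) ^ (e + c) * t := by
      obtain ⟨v, hv⟩ := hw
      -- w^M - 1 = (w-1)S, where p^c divides w-1 and S = p^e (N + p^c z).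
      refine ⟨v * (N + p ^ c * z), ?_⟩
      have h2 := mul_geom_sum w M
      rw [← hS, hz, hv] at h2
      rw [pow_add] at *
      linear_combination -h2
    obtain ⟨o, ho⟩ := hp
    have hsum : ∀ P : ℕ, ∃ y : ℤ, ∑ i ∈ Finset.range P, (w ^ M) ^ i =
        P + (p : ℤ) ^ (e + c) * t * (∑ i ∈ Finset.range P, (i : ℤ)) +
          (p : ℤ) ^ (e + c + 1) * y := by
      intro P
      have h3 : ∀ i ∈ Finset.range P, (w ^ M) ^ i ≡ 1 + (p : ℤ) ^ (e + c) * t * i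
          [ZMOD (p : ℤ) ^ (e + c + 1)] := by
        intro i hi
        rw [ht]
        clear hi
        induction i with
        | zero => simp
        | succ i ihi =>
          rw [pow_succ (1 + (p : ℤ) ^ (e + c) * t)]
          refine (ihi.mul_right _).trans ?_
          refine (Int.modEq_iff_dvd.mpr ?_)
          -- The quadratic terms vanish because e+c+1 ≤ 2(e+c); this is where c ≥ 1 enters.
          have : (p : ℤ) ^ (e + c + 1) ∣ (p : ℤ) ^ (e + c) * (p : ℤ) ^ (e + c) := by
            rw [← pow_add]; exact pow_dvd_pow _ (by omega)
          obtain ⟨f, hf⟩ := this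
          refine ⟨-f * t * t * i, ?_⟩
          push_cast
          linear_combination (-t * t * i) * hf
      have h4 := Int.ModEq.sum h3
      obtain ⟨y, hy⟩ := Int.modEq_iff_dvd.mp h4.symm
      refine ⟨y, ?_⟩
      rw [Finset.sum_add_distrib, ← Finset.mul_sum] at hy
      simp only [Finset.sum_const, Finset.card_range, nsmul_eq_mul, mul_one] at hy
      linear_combination hy
    obtain ⟨y, hy⟩ := hsum p
    -- For odd p the sum p(p-1)/2 is a multiple of p, so the linear terms also vanish modulo
    -- p^(e+c+1).
    have h5 : ∑ i ∈ Finset.range p, (i : ℤ) = p * o := by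
      have := Finset.sum_range_id_mul_two p
      have h6 : (∑ i ∈ Finset.range p, i) = p * o := by
        have h7 : p - 1 = o * 2 := by omega
        rw [h7, ← mul_assoc] at this
        exact Nat.eq_of_mul_eq_mul_right (by norm_num) this
      rw [← Nat.cast_sum, h6]
      push_cast
      rfl
    rw [hprod, hy, hz, h5]
    refine ⟨z + (N * (p : ℤ) ^ e + (p : ℤ) ^ (e + c) * z) * (t * o + y), ?_⟩
    ring

/-! ### Normal form x^i y^j: existence and uniqueness -/

variable {p m n r : ℕ}

theorem Params.odd_p (h : Params p m n r) : Odd p := h.prime.odd_of_ne_two h.odd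

theorem pow_congr {G : Type*} [Group G] {g : G} {N : ℕ} (hg : g ^ N = 1) {a b : ℕ}
    (hab : (a : ZMod N) = b) : g ^ a = g ^ b :=
  pow_eq_pow_of_modEq ((ZMod.natCast_eq_natCast_iff _ _ _).mp hab) hg

theorem genY_pow_mul_genX_pow (j i : ℕ) :
    genY p m n r ^ j * genX p m n r ^ i =
      genX p m n r ^ ((1 + p ^ (m - r)) ^ j * i) * genY p m n r ^ j := by
  have := genY_pow_mul_genX_zpow (p := p) (m := m) (n := n) (r := r) j i
  rw [zpow_natCast] at this
  rw [this, ← zpow_natCast]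
  rfl

theorem normal_mul (i j i' j' : ℕ) :
    (genX p m n r ^ i * genY p m n r ^ j) * (genX p m n r ^ i' * genY p m n r ^ j') =
      genX p m n r ^ (i + (1 + p ^ (m - r)) ^ j * i') * genY p m n r ^ (j + j') := by
  rw [mul_assoc, ← mul_assoc (genY p m n r ^ j), genY_pow_mul_genX_pow, pow_add, pow_add]
  simp only [mul_assoc]

theorem normal_pow (i j N : ℕ) :
    (genX p m n r ^ i * genY p m n r ^ j) ^ N =
      genX p m n r ^ (i * ∑ l ∈ Finset.range N, ((1 + p ^ (m - r)) ^ j) ^ l) *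
        genY p m n r ^ (j * N) := by
  induction N with
  | zero => simp
  | succ N ih =>
    rw [pow_succ, ih, normal_mul, Finset.sum_range_succ, ← pow_mul]
    congr 2
    ring

theorem exists_normal (h : Params p m n r) (g : Grp p m n r) :
    ∃ i j : ℕ, g = genX p m n r ^ i * genY p m n r ^ j := by
  have hg : g ∈ Subgroup.closure (Set.range (PresentedGroup.of (rels := rels p m n r))) := by
    rw [PresentedGroup.closure_range_of]; trivial
  have hp := h.prime.pos
  induction hg using Subgroup.closure_induction with
  | mem g hg =>
    obtain ⟨i, rfl⟩ := hg
    fin_cases i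
    · exact ⟨1, 0, by simp [genX]⟩
    · exact ⟨0, 1, by simp [genY]⟩
  | one => exact ⟨0, 0, by simp⟩
  | mul a b _ _ ha hb =>
    obtain ⟨i, j, rfl⟩ := ha
    obtain ⟨i', j', rfl⟩ := hb
    exact ⟨_, _, normal_mul _ _ _ _⟩
  | inv a _ ha =>
    obtain ⟨i, j, rfl⟩ := ha
    have hX : (genX p m n r)⁻¹ = genX p m n r ^ (p ^ m - 1) := by
      rw [inv_eq_iff_mul_eq_one, ← pow_succ', Nat.sub_add_cancel (Nat.pos_of_ne_zero (by positivity)),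
        genX_pow]
    have hY : (genY p m n r)⁻¹ = genY p m n r ^ (p ^ n - 1) := by
      rw [inv_eq_iff_mul_eq_one, ← pow_succ', Nat.sub_add_cancel (Nat.pos_of_ne_zero (by positivity)),
        genY_pow]
    rw [mul_inv_rev, ← inv_pow, ← inv_pow, hX, hY, ← pow_mul, ← pow_mul, genY_pow_mul_genX_pow]
    exact ⟨_, _, rfl⟩

theorem Params.pow_eq (h : Params p m n r) : p ^ m = p ^ (m - r) * p ^ r := by
  rw [← pow_add, Nat.sub_add_cancel h.r_lt_m.le]

/-- `1 + p^(m-r)` as a unit modulo `p^m`. -/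
noncomputable def kappa (h : Params p m n r) : (ZMod (p ^ m))ˣ :=
  ZMod.unitOfCoprime (1 + p ^ (m - r)) (by
    apply Nat.Coprime.pow_right
    obtain ⟨s, hs⟩ : ∃ s, m - r = s + 1 := ⟨m - r - 1, by have := h.r_lt_m; omega⟩
    rw [hs, pow_succ]
    simp)

theorem kappa_val (h : Params p m n r) : (kappa h : ZMod (p ^ m)) = 1 + (p : ZMod (p ^ m)) ^ (m - r) := by
  simp [kappa]

theorem cast_pow_mul (h : Params p m n r) : (p : ZMod (p ^ m)) ^ (m - r) * (p : ZMod (p ^ m)) ^ r = 0 := by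
  rw [← pow_add, Nat.sub_add_cancel h.r_lt_m.le]
  exact_mod_cast ZMod.natCast_self (p ^ m)

theorem one_add_pow_eq (h : Params p m n r) (e N : ℕ) : ∃ z : ZMod (p ^ m),
    (1 + (p : ZMod (p ^ m)) ^ (m - r)) ^ (p ^ e * N) =
      1 + p ^ (m - r) * (p ^ e * N) + p ^ (m - r) * p ^ (e + (m - r)) * z := by
  obtain ⟨z, hz⟩ := geom_sum_eq_add h.odd_p (c := m - r) (w := 1 + (p : ℤ) ^ (m - r))
    (by have := h.r_lt_m; omega) (by simp) e N
  refine ⟨z, ?_⟩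
  have h1 := mul_geom_sum (1 + (p : ℤ) ^ (m - r)) (p ^ e * N)
  rw [hz] at h1
  have h2 := congrArg (Int.cast : ℤ → ZMod (p ^ m)) h1
  push_cast at h2
  linear_combination -h2

theorem kappa_pow (h : Params p m n r) : kappa h ^ (p ^ r) = 1 := by
  ext
  rw [Units.val_pow_eq_pow_val, Units.val_one, kappa_val]
  obtain ⟨z, hz⟩ := one_add_pow_eq h r 1
  rw [mul_one] at hz
  rw [hz, pow_add]
  have := cast_pow_mul h
  linear_combination (1 + z * (p : ZMod (p ^ m)) ^ (m - r)) * this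

/-- The p^(r-1)-th power equals 1 + p^(m-1), which is not 1. The exact order is what pins the
y-exponent of φ(y) modulo p^r in `aut_form`. -/
theorem orderOf_kappa (h : Params p m n r) : orderOf (kappa h) = p ^ r := by
  have := Fact.mk h.prime
  obtain ⟨s, rfl⟩ := Nat.exists_eq_add_of_le' h.one_le_r
  refine orderOf_eq_prime_pow ?_ (kappa_pow h)
  intro h1
  have h2 := congrArg Units.val h1
  push_cast at h2
  rw [kappa_val] at h2
  obtain ⟨z, hz⟩ := one_add_pow_eq h s 1
  have hlt := h.r_lt_m
  rw [mul_one, h2] at hz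
  have h3 : (p : ZMod (p ^ m)) ^ (m - (s + 1)) * p ^ (s + (m - (s + 1))) = 0 := by
    rw [← pow_add]
    have : (p : ZMod (p ^ m)) ^ m = 0 := by exact_mod_cast ZMod.natCast_self (p ^ m)
    exact pow_eq_zero_of_le (by omega) this
  rw [h3] at hz
  have h4 : ((p ^ (m - 1) : ℕ) : ZMod (p ^ m)) = 0 := by
    have : m - 1 = (m - (s + 1)) + s := by omega
    rw [this, pow_add]
    push_cast at hz ⊢
    linear_combination -hz
  rw [ZMod.natCast_eq_zero_iff] at h4
  have := (Nat.pow_dvd_pow_iff_le_right h.prime.one_lt).mp h4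
  omega

/-- The affine action of `G` on `ℤ/p^m`: `x` acts by translation and `y` by multiplication. -/
noncomputable def affineHom (h : Params p m n r) : Grp p m n r →* Equiv.Perm (ZMod (p ^ m)) :=
  lift (Equiv.addLeft 1) (Units.mulLeft (kappa h))
    (by
      ext z
      simp)
    (by
      have h1 : kappa h ^ (p ^ n) = 1 := by
        have h3 : p ^ n = p ^ r * p ^ (n - r) := by
          rw [← pow_add, Nat.add_sub_cancel' h.r_le_n]
        rw [h3, pow_mul, kappa_pow, one_pow]
      ext z
      have h2 : ∀ N : ℕ, (Units.mulLeft (kappa h) ^ N) z = (kappa h ^ N : (ZMod (p ^ m))ˣ) * z := by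
        intro N
        induction N with
        | zero => simp
        | succ N ih => rw [pow_succ', Equiv.Perm.mul_apply, ih, pow_succ']; simp [mul_assoc]
      rw [h2, h1]
      simp)
    (by
      rw [mul_inv_eq_iff_eq_mul]
      ext z
      simp only [Equiv.Perm.coe_mul, Function.comp_apply, Equiv.coe_addLeft, Units.mulLeft_apply,
        Equiv.nsmul_addLeft, nsmul_eq_mul, mul_one, kappa_val]
      push_cast
      ring)

theorem affineHom_normal (h : Params p m n r) (i j : ℕ) :
    affineHom h (genX p m n r ^ i * genY p m n r ^ j) 0 = i := by
  have h2 : ∀ N : ℕ, (Units.mulLeft (kappa h) ^ N) 0 = 0 := by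
    intro N
    induction N with
    | zero => simp
    | succ N ih => rw [pow_succ', Equiv.Perm.mul_apply, ih]; simp
  rw [map_mul, map_pow, map_pow, affineHom, lift_x, lift_y, Equiv.Perm.mul_apply, h2]
  simp

/-- The projection `G → ℤ/p^n` with `x ↦ 0` and `y ↦ 1`. -/
def yExponent (p m n r : ℕ) : Grp p m n r →* Multiplicative (ZMod (p ^ n)) :=
  lift 1 (Multiplicative.ofAdd 1) (by simp) (by rw [← ofAdd_nsmul]; simp) (by simp)

theorem yExponent_normal (i j : ℕ) :
    yExponent p m n r (genX p m n r ^ i * genY p m n r ^ j) = Multiplicative.ofAdd (j : ZMod (p ^ n)) := by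
  rw [map_mul, map_pow, map_pow, yExponent, lift_x, lift_y, ← ofAdd_nsmul]
  simp

/-- In the affine action y fixes 0 and x translates by 1, so the image of 0 reads off i; the
projection onto ⟨y⟩ reads off j. -/
theorem normal_inj (h : Params p m n r) {i j i' j' : ℕ}
    (he : genX p m n r ^ i * genY p m n r ^ j = genX p m n r ^ i' * genY p m n r ^ j') :
    (i : ZMod (p ^ m)) = i' ∧ (j : ZMod (p ^ n)) = j' := by
  constructor
  · rw [← affineHom_normal h i j, he, affineHom_normal]
  · apply Multiplicative.ofAdd.injective
    rw [← yExponent_normal (m := m) (r := r) i j, he, yExponent_normal]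

/-! ### Inner automorphisms and power maps -/

theorem aut_ext {f g : MulAut (Grp p m n r)} (hx : f (genX p m n r) = g (genX p m n r))
    (hy : f (genY p m n r) = g (genY p m n r)) : f = g := by
  have : f.toMonoidHom = g.toMonoidHom := hom_ext hx hy
  exact MulEquiv.toMonoidHom_injective this

/-- The exponents max{m-n,0} and min{m,n}-r add up to m-r, so both sides fix x and send y to x^q y.
-/
theorem betaTilde_eq (h : Params p m n r) : betaTilde h = (MulAut.conj (genX p m n r))⁻¹ := by
  have h1 : ∀ N : ℕ, (beta h ^ N) (genX p m n r) = genX p m n r ∧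
      (beta h ^ N) (genY p m n r) = genX p m n r ^ (p ^ (m - n) * N) * genY p m n r := by
    intro N
    induction N with
    | zero => simp
    | succ N ih =>
      rw [pow_succ', MulAut.mul_apply, MulAut.mul_apply, ih.1, ih.2, map_mul, map_pow, beta_x,
        beta_y, ← mul_assoc, ← pow_add]
      exact ⟨rfl, by congr 2⟩
  apply aut_ext
  · rw [betaTilde, (h1 _).1]; simp
  · rw [betaTilde, (h1 _).2, ← map_inv, MulAut.conj_apply, inv_inv, ← pow_add]
    have h2 : m - n + (min m n - r) = m - r := by have := h.r_lt_m; have := h.r_le_n; omega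
    rw [h2]
    have h3 := genY_pow_mul_genX_pow (p := p) (m := m) (n := n) (r := r) 1 1
    rw [pow_one, pow_one, mul_one, pow_one] at h3
    rw [mul_assoc, h3, pow_add, pow_one]
    group

theorem conj_genX_inv_pow_genY (N : ℕ) :
    ((MulAut.conj (genX p m n r))⁻¹ ^ N) (genY p m n r) =
      genX p m n r ^ (p ^ (m - r) * N) * genY p m n r := by
  rw [← map_inv, ← map_pow, MulAut.conj_apply, inv_pow, inv_inv]
  have h3 := genY_pow_mul_genX_pow (p := p) (m := m) (n := n) (r := r) 1 N
  rw [pow_one, pow_one] at h3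
  rw [mul_assoc, h3, add_mul, one_mul, pow_add]
  group

theorem conj_genY_pow (N : ℕ) :
    (MulAut.conj (genY p m n r) ^ N) (genX p m n r) =
      genX p m n r ^ ((1 + p ^ (m - r)) ^ N) := by
  rw [← map_pow, MulAut.conj_apply]
  have h3 := genY_pow_mul_genX_pow (p := p) (m := m) (n := n) (r := r) N 1
  rw [pow_one, mul_one] at h3
  rw [h3]
  group

/-- Pairs of an automorphism `f` and a unit `U` with `f g = g^U`. -/
def powerPairs {G : Type*} [Group G] (g : G) {N : ℕ} [NeZero N] (hg : g ^ N = 1) :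
    Subgroup (MulAut G × (ZMod N)ˣ) where
  carrier := {s | s.1 g = g ^ (s.2 : ZMod N).val}
  one_mem' := by
    change g = g ^ ((1 : ZMod N)).val
    conv_lhs => rw [← pow_one g]
    exact pow_congr hg (by simp)
  mul_mem' := by
    intro a b ha hb
    change a.1 (b.1 g) = g ^ ((a.2 * b.2 : (ZMod N)ˣ) : ZMod N).val
    rw [show b.1 g = _ from hb, map_pow, show a.1 g = _ from ha, ← pow_mul]
    exact pow_congr hg (by simp)
  inv_mem' := by
    intro a ha
    change a.1⁻¹ g = g ^ ((a.2⁻¹ : (ZMod N)ˣ) : ZMod N).val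
    have : a.1 (g ^ ((a.2⁻¹ : (ZMod N)ˣ) : ZMod N).val) = g := by
      rw [map_pow, show a.1 g = _ from ha, ← pow_mul]
      conv_rhs => rw [← pow_one g]
      exact pow_congr hg (by simp)
    nth_rewrite 1 [← this]
    exact MulAut.inv_apply_self _ _ _

/-- Since the pairs form a subgroup, negative exponents need no separate treatment. -/
theorem zpow_apply_eq_pow {G : Type*} [Group G] {g : G} {N : ℕ} [NeZero N] (hg : g ^ N = 1)
    {f : MulAut G} {U : (ZMod N)ˣ} (hf : f g = g ^ (U : ZMod N).val) (a : ℤ) :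
    (f ^ a) g = g ^ ((U ^ a : (ZMod N)ˣ) : ZMod N).val :=
  Subgroup.zpow_mem (powerPairs g hg) (x := (f, U)) hf a

theorem cast_pow_m : (p : ZMod (p ^ m)) ^ m = 0 := by
  exact_mod_cast ZMod.natCast_self (p ^ m)

theorem geom_sum_cast_eq (h : Params p m n r) (j e N : ℕ) : ∃ z : ZMod (p ^ m),
    ((∑ l ∈ Finset.range (p ^ e * N), ((1 + p ^ (m - r)) ^ j) ^ l : ℕ) : ZMod (p ^ m)) =
      p ^ e * N + p ^ (e + (m - r)) * z := by
  obtain ⟨z, hz⟩ := geom_sum_eq_add h.odd_p (c := m - r) (w := (1 + (p : ℤ) ^ (m - r)) ^ j)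
    (by have := h.r_lt_m; omega)
    (by simpa using sub_dvd_pow_sub_pow (1 + (p : ℤ) ^ (m - r)) 1 j) e N
  refine ⟨z, ?_⟩
  have h2 := congrArg (Int.cast : ℤ → ZMod (p ^ m)) hz
  push_cast at h2 ⊢
  exact h2

theorem exists_pow_eq (j : ℕ) : ∃ v : ZMod (p ^ m),
    (1 + (p : ZMod (p ^ m)) ^ (m - r)) ^ j = 1 + p ^ (m - r) * v := by
  obtain ⟨v, hv⟩ := sub_dvd_pow_sub_pow (1 + (p : ZMod (p ^ m)) ^ (m - r)) 1 j
  rw [one_pow, add_sub_cancel_left] at hv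
  exact ⟨v, by linear_combination hv⟩

/-- Apart from the leading 1, the sum is the ratio times a sum of p^r w terms. The latter is p^r w
modulo p^r q = p^m, and the ratio, being 1 modulo q, fixes p^r w. Consequently raising to an
exponent ≡ 1 mod p^r acts coordinatewise on normal forms. -/
theorem geom_sum_central (h : Params p m n r) (j w : ℕ) :
    ((∑ l ∈ Finset.range (p ^ r * w + 1), ((1 + p ^ (m - r)) ^ j) ^ l : ℕ) : ZMod (p ^ m)) =
      (p ^ r * w + 1 : ℕ) := by
  obtain ⟨z, hz⟩ := geom_sum_cast_eq h j r w
  obtain ⟨v, hv⟩ := exists_pow_eq (p := p) (m := m) (r := r) j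
  have h0 := cast_pow_mul h
  rw [pow_add] at hz
  rw [Finset.sum_range_succ']
  simp only [pow_succ _, ← Finset.sum_mul]
  push_cast at hz ⊢
  rw [hz, hv]
  linear_combination (w * v + z + p ^ (m - r) * v * z) * h0

theorem normal_pow_central (h : Params p m n r) (i j w : ℕ) :
    (genX p m n r ^ i * genY p m n r ^ j) ^ (p ^ r * w + 1) =
      genX p m n r ^ (i * (p ^ r * w + 1)) * genY p m n r ^ (j * (p ^ r * w + 1)) := by
  rw [normal_pow]
  congr 1
  apply pow_congr genX_pow
  rw [Nat.cast_mul, geom_sum_central h, ← Nat.cast_mul]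

/-- The error in the linear expansion is a multiple of p^(2(m-r) + max{2r-m,0}), and that exponent
is at least m. -/
theorem one_add_pow_eq_linear (h : Params p m n r) {b : ℕ}
    (hb : p ^ (2 * r - m) ∣ b ∨ (1 ≤ b ∧ p ^ (2 * r - m) ∣ b - 1)) :
    (1 + (p : ZMod (p ^ m)) ^ (m - r)) ^ b = 1 + b * p ^ (m - r) := by
  have hr := h.r_lt_m
  have h0 : (p : ZMod (p ^ m)) ^ (m - r) * p ^ (2 * r - m + (m - r)) = 0 := by
    rw [← pow_add]; exact pow_eq_zero_of_le (by omega) cast_pow_m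
  rcases hb with ⟨N, rfl⟩ | ⟨h1, N, hN⟩
  · obtain ⟨z, hz⟩ := one_add_pow_eq h (2 * r - m) N
    rw [hz]
    push_cast
    linear_combination z * h0
  · obtain ⟨z, hz⟩ := one_add_pow_eq h (2 * r - m) N
    obtain rfl : b = p ^ (2 * r - m) * N + 1 := by omega
    rw [pow_succ, hz]
    push_cast
    rw [pow_add] at *
    linear_combination (z * (1 + (p : ZMod (p ^ m)) ^ (m - r)) + N) * h0

theorem conj_genX_inv_pow_genX (N : ℕ) :
    ((MulAut.conj (genX p m n r))⁻¹ ^ N) (genX p m n r) = genX p m n r := by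
  rw [← map_inv, ← map_pow, MulAut.conj_apply]; group

theorem conj_genY_pow_genY (N : ℕ) :
    (MulAut.conj (genY p m n r) ^ N) (genY p m n r) = genY p m n r := by
  rw [← map_pow, MulAut.conj_apply]; group

/-- Conjugation by x^e fixes x and sends y to x^(-qe) y, so only qe matters. -/
theorem conj_genX_congr {e f : ℕ}
    (hef : (p : ZMod (p ^ m)) ^ (m - r) * e = p ^ (m - r) * f) :
    MulAut.conj (genX p m n r) ^ e = MulAut.conj (genX p m n r) ^ f := by
  apply inv_injective
  rw [← inv_pow, ← inv_pow]
  apply aut_ext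
  · rw [conj_genX_inv_pow_genX, conj_genX_inv_pow_genX]
  · rw [conj_genX_inv_pow_genY, conj_genX_inv_pow_genY]
    congr 1
    apply pow_congr genX_pow
    push_cast
    exact hef

theorem conj_genY_pow_eq_one (h : Params p m n r) (j : ℕ) :
    MulAut.conj (genY p m n r) ^ (p ^ r * j) = 1 := by
  rw [pow_mul]
  have : MulAut.conj (genY p m n r) ^ (p ^ r) = 1 := by
    apply aut_ext
    · rw [← map_pow, MulAut.conj_apply, h.genY_pow_commute.eq, mul_inv_cancel_right]
      rfl
    · rw [conj_genY_pow_genY]; rfl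
  rw [this, one_pow]

theorem conj_aut_apply {G : Type*} [Group G] (φ : MulAut G) (g : G) :
    MulAut.conj (φ g) = φ * MulAut.conj g * φ⁻¹ := by
  ext z
  simp [MulAut.mul_apply]

theorem conj_aut_inv_pow {G : Type*} [Group G] (φ : MulAut G) (g : G) (b : ℕ) :
    φ * (MulAut.conj g)⁻¹ ^ b * φ⁻¹ = (MulAut.conj (φ g))⁻¹ ^ b := by
  rw [conj_aut_apply, ← conj_pow, conj_inv]

/-! ### Commuting inner automorphisms and the automorphism x ↦ xy, for n ≤ m - r -/

/-- From r ≤ n ≤ m-r one gets q² = 0 mod p^m, so x^q is central and conj(x)^(1+q) = conj(x). -/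
theorem conj_generators_commute (h : Params p m n r) (hn : n ≤ m - r) :
    Commute (MulAut.conj (genX p m n r)) (MulAut.conj (genY p m n r)) := by
  have hr := h.r_le_n
  have h1 : MulAut.conj (genX p m n r) ^ (1 + p ^ (m - r)) = MulAut.conj (genX p m n r) := by
    conv_rhs => rw [← pow_one (MulAut.conj (genX p m n r))]
    apply conj_genX_congr
    have : (p : ZMod (p ^ m)) ^ (m - r) * p ^ (m - r) = 0 := by
      rw [← pow_add]; exact pow_eq_zero_of_le (by omega) cast_pow_m
    push_cast
    linear_combination this
  have h2 := congrArg MulAut.conj (genY_conj (p := p) (m := m) (n := n) (r := r))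
  rw [map_pow, h1, map_mul, map_mul, map_inv, mul_inv_eq_iff_eq_mul] at h2
  exact h2.symm

theorem conj_commute (h : Params p m n r) (hn : n ≤ m - r) (g g' : Grp p m n r) :
    Commute (MulAut.conj g) (MulAut.conj g') := by
  obtain ⟨i, j, rfl⟩ := exists_normal h g
  obtain ⟨i', j', rfl⟩ := exists_normal h g'
  have hc := conj_generators_commute h hn
  simp only [map_mul, map_pow]
  exact ((((Commute.refl _).pow_pow i i').mul_right (hc.pow_pow i j'))).mul_left
    ((hc.symm.pow_pow j i').mul_right ((Commute.refl _).pow_pow j j'))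

/-- The geometric sum of q terms is q modulo q² = 0, and y^q = 1 since p^n divides q. This makes x
y^c satisfy the relations imposed on x. -/
theorem genX_mul_genY_pow_pow (h : Params p m n r) (hn : n ≤ m - r) (c : ℕ) :
    (genX p m n r * genY p m n r ^ c) ^ (p ^ (m - r)) = genX p m n r ^ (p ^ (m - r)) := by
  have hr := h.r_le_n
  have h1 := normal_pow (p := p) (m := m) (n := n) (r := r) 1 c (p ^ (m - r))
  rw [pow_one] at h1
  obtain ⟨z, hz⟩ := geom_sum_cast_eq h c (m - r) 1
  have h3 : (p : ZMod (p ^ m)) ^ (m - r + (m - r)) = 0 :=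
    pow_eq_zero_of_le (by omega) cast_pow_m
  rw [mul_one, h3] at hz
  have h4 : genX p m n r ^ (1 * ∑ l ∈ Finset.range (p ^ (m - r)), ((1 + p ^ (m - r)) ^ c) ^ l) =
      genX p m n r ^ (p ^ (m - r)) := by
    apply pow_congr genX_pow
    rw [one_mul, hz]
    push_cast
    ring
  have h5 : genY p m n r ^ (c * p ^ (m - r)) = 1 := by
    obtain ⟨s, hs⟩ := Nat.exists_eq_add_of_le hn
    rw [hs, pow_add, mul_comm, mul_assoc, pow_mul, genY_pow, one_pow]
  rw [h1, h4, h5, mul_one]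

/-- The endomorphism `x ↦ x y^c`, `y ↦ y`, in the case `n ≤ m - r`. -/
def gammaHom (h : Params p m n r) (hn : n ≤ m - r) (c : ℕ) : Grp p m n r →* Grp p m n r :=
  lift (genX p m n r * genY p m n r ^ c) (genY p m n r)
    (by rw [h.pow_eq, pow_mul, genX_mul_genY_pow_pow h hn, ← pow_mul, ← h.pow_eq, genX_pow])
    genY_pow
    (by
      rw [pow_add, pow_one, genX_mul_genY_pow_pow h hn]
      have h1 := genY_conj (p := p) (m := m) (n := n) (r := r)
      have h2 : genY p m n r ^ c * genX p m n r ^ (p ^ (m - r)) =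
          genX p m n r ^ (p ^ (m - r)) * genY p m n r ^ c := by
        rw [genY_pow_mul_genX_pow]
        congr 1
        apply pow_congr genX_pow
        obtain ⟨v, hv⟩ := exists_pow_eq (p := p) (m := m) (r := r) c
        push_cast
        rw [hv]
        have : (p : ZMod (p ^ m)) ^ (m - r) * p ^ (m - r) = 0 := by
          have hr := h.r_le_n
          rw [← pow_add]; exact pow_eq_zero_of_le (by omega) cast_pow_m
        linear_combination v * this
      rw [mul_assoc (genX p m n r), h2, ← mul_assoc (genX p m n r), ← pow_succ', add_comm, ← h1]
      group)

theorem gammaHom_comp (h : Params p m n r) (hn : n ≤ m - r) {c d : ℕ} (hcd : p ^ n ∣ c + d) :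
    (gammaHom h hn c).comp (gammaHom h hn d) = MonoidHom.id _ := by
  apply hom_ext
  · simp only [gammaHom, MonoidHom.comp_apply, lift_x, lift_y, map_mul, map_pow, MonoidHom.id_apply]
    obtain ⟨e, he⟩ := hcd
    rw [mul_assoc, ← pow_add, he, pow_mul, genY_pow, one_pow, mul_one]
  · simp [gammaHom, lift_y]

theorem exists_aut_mul_genY (h : Params p m n r) (hn : n ≤ m - r) :
    ∃ γ : MulAut (Grp p m n r), γ (genX p m n r) = genX p m n r * genY p m n r ∧
      γ (genY p m n r) = genY p m n r := by
  have h1 : 1 + (p ^ n - 1) = p ^ n := by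
    have := Nat.pos_of_ne_zero (pow_ne_zero n h.prime.ne_zero); omega
  refine ⟨MonoidHom.toMulEquiv (gammaHom h hn 1) (gammaHom h hn (p ^ n - 1))
    (gammaHom_comp h hn (by rw [add_comm, h1])) (gammaHom_comp h hn (by rw [h1])), ?_, ?_⟩
  · change gammaHom h hn 1 (genX p m n r) = _
    rw [gammaHom, lift_x, pow_one]
  · change gammaHom h hn 1 (genY p m n r) = _
    rw [gammaHom, lift_y]

/-! ### Shape of the automorphisms for m ≤ n -/

theorem aut_form (h : Params p m n r) (hmn : m ≤ n) (φ : MulAut (Grp p m n r)) :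
    ∃ i j s t : ℕ, φ (genX p m n r) = genX p m n r ^ i * genY p m n r ^ (p ^ r * j) ∧
      φ (genY p m n r) = genX p m n r ^ s * genY p m n r ^ (p ^ r * t + 1) := by
  have hr := h.r_lt_m
  have hrn := h.r_le_n
  have hppos : ∀ k, 0 < p ^ k := fun k => Nat.pos_of_ne_zero (pow_ne_zero _ h.prime.ne_zero)
  obtain ⟨i, j, hx⟩ := exists_normal h (φ (genX p m n r))
  obtain ⟨s, t, hy⟩ : ∃ s t : ℕ, φ (genY p m n r) = genX p m n r ^ s * genY p m n r ^ (t + 1) := by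
    obtain ⟨s, t, hy⟩ := exists_normal h (φ (genY p m n r))
    -- Adding p^n to the exponent of y makes it a successor without changing the element.
    refine ⟨s, t + (p ^ n - 1), ?_⟩
    have := hppos n
    rw [hy, show t + (p ^ n - 1) + 1 = t + p ^ n by omega, pow_add, genY_pow, mul_one]
  have hrel : φ (genY p m n r) * φ (genX p m n r) =
      φ (genX p m n r) ^ (1 + p ^ (m - r)) * φ (genY p m n r) := by
    rw [← map_mul, ← map_pow, ← map_mul, ← genY_conj]
    congr 1
    group
  have hexp := hrel
  rw [hx, hy, normal_mul, normal_pow, normal_mul] at hexp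
  have hj := (normal_inj h hexp).2
  -- The y-exponents in the relation give jq = 0 mod p^n.
  have hjd : p ^ (n - m + r) ∣ j := by
    have h1 : ((j * p ^ (m - r) : ℕ) : ZMod (p ^ n)) = 0 := by
      push_cast at hj ⊢
      linear_combination -hj
    rw [ZMod.natCast_eq_zero_iff] at h1
    have h2 : p ^ n = p ^ (n - m + r) * p ^ (m - r) := by rw [← pow_add]; congr 1; omega
    rw [h2] at h1
    exact Nat.dvd_of_mul_dvd_mul_right (hppos _) h1
  -- Otherwise φ(x)^(p^(m-1)) = 1, contradicting the order of x.
  have hi : i.Coprime p := by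
    rw [Nat.coprime_comm, h.prime.coprime_iff_not_dvd]
    rintro ⟨i', rfl⟩
    have h1 : φ (genX p m n r) ^ (p ^ (m - 1)) = 1 := by
      rw [hx, normal_pow]
      obtain ⟨z, hz⟩ := geom_sum_cast_eq h j (m - 1) 1
      rw [mul_one] at hz
      have e1 : genX p m n r ^ (p * i' * ∑ l ∈ Finset.range (p ^ (m - 1)),
          ((1 + p ^ (m - r)) ^ j) ^ l) = 1 := by
        rw [← pow_zero (genX p m n r)]
        apply pow_congr genX_pow
        rw [Nat.cast_mul, hz]
        have e3 : (p : ZMod (p ^ m)) * p ^ (m - 1) = 0 := by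
          rw [← pow_succ']; exact pow_eq_zero_of_le (by omega) cast_pow_m
        rw [pow_add]
        push_cast
        linear_combination (i' + i' * p ^ (m - r) * z) * e3
      have e2 : genY p m n r ^ (j * p ^ (m - 1)) = 1 := by
        obtain ⟨j', rfl⟩ := hjd
        have : p ^ (n - m + r) * j' * p ^ (m - 1) = p ^ n * (p ^ (r - 1) * j') := by
          have e4 : n - m + r + (m - 1) = n + (r - 1) := by have := h.one_le_r; omega
          calc _ = p ^ (n - m + r + (m - 1)) * j' := by rw [pow_add]; ring
            _ = _ := by rw [e4, pow_add]; ring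
        rw [this, pow_mul, genY_pow, one_pow]
      rw [e1, e2, mul_one]
    rw [← map_pow, map_eq_one_iff φ φ.injective] at h1
    have h2 := normal_inj h (i := p ^ (m - 1)) (j := 0) (i' := 0) (j' := 0) (by simpa using h1)
    have h3 := h2.1
    rw [Nat.cast_zero, ZMod.natCast_eq_zero_iff, Nat.pow_dvd_pow_iff_le_right h.prime.one_lt] at h3
    omega
  obtain ⟨j', rfl⟩ : p ^ r ∣ j := (pow_dvd_pow p (by omega)).trans hjd
  have hkj : ((1 + p ^ (m - r) : ℕ) : ZMod (p ^ m)) ^ (p ^ r * j') = 1 := by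
    have := congrArg Units.val (kappa_pow h)
    rw [Units.val_pow_eq_pow_val, kappa_val] at this
    rw [pow_mul]
    push_cast
    rw [this]
    simp
  -- As y^(p^r) centralizes x, the x-exponents in the relation reduce to κ^(t+1) i = κ i, and i is a
  -- unit.
  have hk : kappa h ^ (t + 1) = kappa h ^ 1 := by
    have h1 := (normal_inj h hexp).1
    have h2 : ((∑ l ∈ Finset.range (1 + p ^ (m - r)), ((1 + p ^ (m - r)) ^ (p ^ r * j')) ^ l : ℕ) :
        ZMod (p ^ m)) = 1 + p ^ (m - r) := by
      simp only [Nat.cast_sum, Nat.cast_pow, hkj, one_pow]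
      simp
    have h3 : ((1 + p ^ (m - r) : ℕ) : ZMod (p ^ m)) ^ (p ^ r * j' * (1 + p ^ (m - r))) = 1 := by
      rw [pow_mul, hkj, one_pow]
    rw [Nat.cast_add, Nat.cast_add, Nat.cast_mul, Nat.cast_mul, Nat.cast_mul, h2, Nat.cast_pow,
      Nat.cast_pow, h3] at h1
    have hu : IsUnit (i : ZMod (p ^ m)) := by
      rw [ZMod.isUnit_iff_coprime]; exact hi.pow_right m
    ext
    rw [Units.val_pow_eq_pow_val, pow_one, kappa_val]
    push_cast at h1
    apply hu.mul_right_cancel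
    linear_combination h1
  rw [pow_eq_pow_iff_modEq, orderOf_kappa] at hk
  obtain ⟨t', ht'⟩ := (Nat.modEq_iff_dvd' (by omega)).mp hk.symm
  refine ⟨i, j', s, t', hx, ?_⟩
  rw [hy]
  congr 2
  omega

theorem conj_genX_inv_pow_normal (b i j : ℕ) :
    ((MulAut.conj (genX p m n r))⁻¹ ^ b) (genX p m n r ^ i * genY p m n r ^ j) =
      genX p m n r ^ i * (genX p m n r ^ (p ^ (m - r) * b) * genY p m n r) ^ j := by
  rw [map_mul, map_pow, map_pow, conj_genX_inv_pow_genX, conj_genX_inv_pow_genY]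

/-! ### Necessity and sufficiency in both cases -/

section
variable {η : MulAut (Grp p m n r)} {A w b : ℕ}

theorem eq_of_equivariant_of_le (h : Params p m n r) (hmn : m ≤ n)
    (hx : η (genX p m n r) = genX p m n r ^ A)
    (hy : η (genY p m n r) = genY p m n r ^ (p ^ r * w + 1))
    (hA : IsUnit (A : ZMod (p ^ m)))
    {Γ : Grp p m n r → MulAut (Grp p m n r)}
    (hΓx : Γ (genX p m n r) = (MulAut.conj (genX p m n r))⁻¹ ^ b)
    (hΓy : Γ (genY p m n r) = η) (hanti : IsAntihom Γ) (heq : IsAutEquivariant Γ) :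
    (A : ZMod (p ^ m)) * (1 + b * p ^ (m - r)) = (p ^ r * w + 1 : ℕ) ∧
      (b : ZMod (p ^ m)) * (b - 1) * (p ^ (m - r) * p ^ (m - r)) = 0 := by
  have hXV := normal_pow_central (p := p) (m := m) (n := n) (r := r) h
  have h1 : (A : ZMod (p ^ m)) * (1 + b * p ^ (m - r)) = (p ^ r * w + 1 : ℕ) := by
    have hβ : beta h (genY p m n r) = genX p m n r * genY p m n r := by
      rw [beta_y, Nat.sub_eq_zero_of_le hmn, pow_zero, pow_one]
    -- With β(y) = xy this reads ηΓ(x)β = βη; at y the x-exponents are A(1+bq) on the left and, from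
    -- (xy)^V, V on the right.
    have e1 := heq (beta h) (genY p m n r)
    rw [hβ, hanti, hΓx, hΓy, eq_mul_inv_iff_mul_eq] at e1
    have e2 := DFunLike.congr_fun e1 (genY p m n r)
    have e4 := conj_genX_inv_pow_normal (p := p) (m := m) (n := n) (r := r) b 1 1
    have e5 := hXV 1 1 w
    simp only [pow_one, one_mul] at e4 e5
    rw [MulAut.mul_apply, MulAut.mul_apply, hβ, MulAut.mul_apply, e4, map_mul, map_mul, map_pow, hx,
      hy, map_pow, hβ, e5, ← pow_mul, ← mul_assoc, ← pow_add] at e2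
    have e3 := (normal_inj h e2).1
    push_cast at e3 ⊢
    linear_combination e3
  refine ⟨h1, ?_⟩
  have e1 : genY p m n r * genX p m n r = genX p m n r ^ (1 + p ^ (m - r)) * genY p m n r := by
    rw [← genY_conj]; group
  have hpow : ∀ N : ℕ, Γ (genX p m n r ^ (N + 1)) = Γ (genX p m n r) ^ (N + 1) := by
    intro N
    induction N with
    | zero => simp
    | succ N ih => rw [pow_succ, hanti, ih, ← pow_succ']
  -- An antihomomorphism turns the relation into Γ(x)η = ηΓ(x)^(1+q). Evaluating at y and replacing
  -- V by A(1+bq) leaves b(1+bq)q = b(1+q)q after cancelling A.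
  have e2 := congrArg Γ e1
  rw [hanti, hanti, add_comm, hpow, hΓx, hΓy, ← pow_mul] at e2
  have e3 := DFunLike.congr_fun e2 (genY p m n r)
  rw [MulAut.mul_apply, MulAut.mul_apply, hy, map_pow, conj_genX_inv_pow_genY,
    conj_genX_inv_pow_genY, map_mul, map_pow, hx, hy] at e3
  have e5 := hXV (p ^ (m - r) * b) 1 w
  simp only [pow_one, one_mul] at e5
  rw [e5, ← pow_mul] at e3
  have e6 := (normal_inj h e3).1
  apply hA.mul_left_cancel
  rw [Nat.cast_mul, ← h1] at e6
  push_cast at e6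
  linear_combination e6

theorem eq_of_equivariant_of_le_sub (h : Params p m n r) (hn : n ≤ m - r) {V : ℕ}
    (hx : η (genX p m n r) = genX p m n r ^ A)
    (hy : η (genY p m n r) = genY p m n r ^ V)
    {Γ : Grp p m n r → MulAut (Grp p m n r)}
    (hΓx : Γ (genX p m n r) = (MulAut.conj (genX p m n r))⁻¹ ^ b)
    (hΓy : Γ (genY p m n r) = η) (hanti : IsAntihom Γ) (heq : IsAutEquivariant Γ) :
    (A : ZMod (p ^ m)) * (1 + p ^ (m - r)) ^ b = 1 ∧ (V : ZMod (p ^ n)) = 1 := by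
  obtain ⟨γ, hγ, -⟩ := exists_aut_mul_genY h hn
  -- Equivariance gives ηΓ(x) = conj(xy)^(-b) = conj(y)^(-b) conj(x)^(-b); cancelling Γ(x)
  -- identifies η.
  have e1 := heq γ (genX p m n r)
  rw [hγ, hanti, hΓx, hΓy, conj_aut_inv_pow, hγ, map_mul, mul_inv_rev,
    (conj_generators_commute h hn).symm.inv_inv.mul_pow, mul_left_inj, inv_pow,
    eq_inv_iff_mul_eq_one] at e1
  constructor
  · have e2 := DFunLike.congr_fun e1 (genX p m n r)
    rw [MulAut.mul_apply, conj_genY_pow, map_pow, hx, ← pow_mul] at e2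
    have e3 := (normal_inj h (j := 0) (j' := 0) (i' := 1) (by simpa using e2)).1
    push_cast at e3
    exact e3
  · have e2 := DFunLike.congr_fun e1 (genY p m n r)
    rw [MulAut.mul_apply, conj_genY_pow_genY, hy] at e2
    have e3 := (normal_inj h (i := 0) (i' := 0) (j' := 1) (by simpa using e2)).2
    simpa using e3

theorem exists_equivariant_of_le_sub (h : Params p m n r) (hn : n ≤ m - r) {V : ℕ}
    (hx : η (genX p m n r) = genX p m n r ^ A)
    (hy : η (genY p m n r) = genY p m n r ^ V)
    (hA : (A : ZMod (p ^ m)) * (1 + p ^ (m - r)) ^ b = 1) (hV : (V : ZMod (p ^ n)) = 1) :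
    ∃ Γ : Grp p m n r → MulAut (Grp p m n r),
      Γ (genX p m n r) = (MulAut.conj (genX p m n r))⁻¹ ^ b ∧ Γ (genY p m n r) = η ∧
      IsAntihom Γ ∧ IsAutEquivariant Γ := by
  refine ⟨fun g => (MulAut.conj g)⁻¹ ^ b, rfl, ?_, ?_, ?_⟩
  · change (MulAut.conj (genY p m n r))⁻¹ ^ b = η
    rw [inv_pow, eq_comm, eq_inv_iff_mul_eq_one]
    apply aut_ext
    · rw [MulAut.mul_apply, conj_genY_pow, map_pow, hx, ← pow_mul]
      change _ = genX p m n r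
      conv_rhs => rw [← pow_one (genX p m n r)]
      apply pow_congr genX_pow
      push_cast
      exact hA
    · rw [MulAut.mul_apply, conj_genY_pow_genY, hy]
      change _ = genY p m n r
      conv_rhs => rw [← pow_one (genY p m n r)]
      apply pow_congr genY_pow
      simpa using hV
  · intro σ τ
    change (MulAut.conj (σ * τ))⁻¹ ^ b = (MulAut.conj τ)⁻¹ ^ b * (MulAut.conj σ)⁻¹ ^ b
    rw [map_mul, mul_inv_rev, (conj_commute h hn τ σ).inv_inv.mul_pow]
  · intro φ σ
    exact (conj_aut_inv_pow φ σ b).symm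

theorem mul_conj_pow_apply (h : Params p m n r)
    (hx : η (genX p m n r) = genX p m n r ^ A)
    (hy : η (genY p m n r) = genY p m n r ^ (p ^ r * w + 1))
    (hA : (A : ZMod (p ^ m)) * (1 + p ^ (m - r)) ^ b = (p ^ r * w + 1 : ℕ)) (g : Grp p m n r) :
    (η * MulAut.conj (genY p m n r) ^ b) g = g ^ (p ^ r * w + 1) := by
  obtain ⟨i, j, rfl⟩ := exists_normal h g
  rw [normal_pow_central h, MulAut.mul_apply, map_mul, map_pow, map_pow, conj_genY_pow,
    conj_genY_pow_genY, map_mul, map_pow, map_pow, map_pow, hx, hy, ← pow_mul, ← pow_mul,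
    ← pow_mul, mul_comm j]
  congr 1
  apply pow_congr genX_pow
  push_cast at hA ⊢
  linear_combination (i : ZMod (p ^ m)) * hA

theorem equivariant_genY (h : Params p m n r)
    (hx : η (genX p m n r) = genX p m n r ^ A)
    (hy : η (genY p m n r) = genY p m n r ^ (p ^ r * w + 1))
    (hA : (A : ZMod (p ^ m)) * (1 + p ^ (m - r)) ^ b = (p ^ r * w + 1 : ℕ))
    (hb : (1 + (p : ZMod (p ^ m)) ^ (m - r)) ^ b = 1 + b * p ^ (m - r))
    {φ : MulAut (Grp p m n r)} {s t : ℕ}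
    (hφ : φ (genY p m n r) = genX p m n r ^ s * genY p m n r ^ (p ^ r * t + 1)) :
    η * ((MulAut.conj (genX p m n r))⁻¹ ^ b) ^ s = φ * η * φ⁻¹ := by
  have hπ := mul_conj_pow_apply h hx hy hA
  set π := η * MulAut.conj (genY p m n r) ^ b with hπdef
  have hη : η = π * (MulAut.conj (genY p m n r))⁻¹ ^ b := by
    rw [hπdef, inv_pow, mul_inv_cancel_right]
  have hcomm : φ * π = π * φ := by
    -- π is a power map, and every homomorphism commutes with power maps.
    ext g
    change φ (π g) = π (φ g)
    rw [hπ, hπ, map_pow]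
  have e1 : φ * η * φ⁻¹ = π * (MulAut.conj (φ (genY p m n r)))⁻¹ ^ b := by
    rw [← conj_aut_inv_pow, hη, ← mul_assoc, hcomm]
    simp only [mul_assoc]
  have e2 : MulAut.conj (φ (genY p m n r)) = MulAut.conj (genX p m n r ^ s * genY p m n r) := by
    rw [hφ, map_mul, map_pow (MulAut.conj) (genY p m n r), pow_succ, conj_genY_pow_eq_one h, one_mul, ← map_mul]
  have e3 : MulAut.conj (genX p m n r ^ s * genY p m n r) ^ b =
      MulAut.conj (genX p m n r) ^ (s * b) * MulAut.conj (genY p m n r) ^ b := by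
    have e4 := normal_pow (p := p) (m := m) (n := n) (r := r) s 1 b
    rw [pow_one, one_mul, pow_one] at e4
    rw [← map_pow, e4, map_mul, map_pow, map_pow]
    congr 1
    -- The exponent of conj(x) is s times a geometric sum, and q times that sum is (1+q)^b - 1 = bq.
    apply conj_genX_congr
    have e5 := mul_geom_sum (1 + (p : ZMod (p ^ m)) ^ (m - r)) b
    rw [hb] at e5
    push_cast
    linear_combination (s : ZMod (p ^ m)) * e5
  rw [e1, e2, inv_pow (MulAut.conj (genX p m n r ^ s * genY p m n r)), e3, mul_inv_rev, hη,
    ← pow_mul, mul_comm s, inv_pow, inv_pow, mul_assoc]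

theorem exists_equivariant_of_le (h : Params p m n r) (hmn : m ≤ n)
    (hx : η (genX p m n r) = genX p m n r ^ A)
    (hy : η (genY p m n r) = genY p m n r ^ (p ^ r * w + 1))
    (hη : η ^ (p ^ r) = 1)
    (hA : (A : ZMod (p ^ m)) * (1 + b * p ^ (m - r)) = (p ^ r * w + 1 : ℕ))
    (hb : (1 + (p : ZMod (p ^ m)) ^ (m - r)) ^ b = 1 + b * p ^ (m - r))
    (hbb : (b : ZMod (p ^ m)) * (b - 1) * (p ^ (m - r) * p ^ (m - r)) = 0) :
    ∃ Γ : Grp p m n r → MulAut (Grp p m n r),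
      Γ (genX p m n r) = (MulAut.conj (genX p m n r))⁻¹ ^ b ∧ Γ (genY p m n r) = η ∧
      IsAntihom Γ ∧ IsAutEquivariant Γ := by
  set ξ := (MulAut.conj (genX p m n r))⁻¹ ^ b with hξ
  have hξp : ξ ^ (p ^ m) = 1 := by
    rw [hξ, ← pow_mul, mul_comm, pow_mul, inv_pow, ← map_pow, genX_pow, map_one, inv_one, one_pow]
  have hηpow : ∀ N, η ^ (p ^ r * N) = 1 := fun N => by rw [pow_mul, hη, one_pow]
  have hηn : η ^ (p ^ n) = 1 := by
    have : p ^ n = p ^ r * p ^ (n - r) := by rw [← pow_add, Nat.add_sub_cancel' h.r_le_n]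
    rw [this, hηpow]
  have hrel : ξ * η = η * ξ ^ (1 + p ^ (m - r)) := by
    rw [hξ, ← pow_mul]
    apply aut_ext
    · rw [MulAut.mul_apply, MulAut.mul_apply, conj_genX_inv_pow_genX, hx, map_pow,
        conj_genX_inv_pow_genX]
    · rw [MulAut.mul_apply, MulAut.mul_apply, hy, map_pow, conj_genX_inv_pow_genY,
        conj_genX_inv_pow_genY, map_mul, map_pow, hx, hy]
      have e5 := normal_pow_central (n := n) h (p ^ (m - r) * b) 1 w
      simp only [pow_one, one_mul] at e5
      rw [e5, ← pow_mul]
      congr 1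
      apply pow_congr genX_pow
      rw [Nat.cast_mul, ← hA]
      push_cast
      linear_combination (A : ZMod (p ^ m)) * hbb
  -- Viewing Γ as a homomorphism into the opposite group allows it to be defined, and its
  -- equivariance checked, on generators.
  let F : Grp p m n r →* (MulAut (Grp p m n r))ᵐᵒᵖ :=
    lift (MulOpposite.op ξ) (MulOpposite.op η)
      (by rw [← MulOpposite.op_pow, hξp, MulOpposite.op_one])
      (by rw [← MulOpposite.op_pow, hηn, MulOpposite.op_one])
      (by
        rw [mul_inv_eq_iff_eq_mul, ← MulOpposite.op_pow, ← MulOpposite.op_mul, ← MulOpposite.op_mul,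
          hrel])
  have hFx : F (genX p m n r) = MulOpposite.op ξ := lift_x _ _ _
  have hFy : F (genY p m n r) = MulOpposite.op η := lift_y _ _ _
  refine ⟨fun g => (F g).unop, ?_, ?_, ?_, ?_⟩
  · simp only [hFx, MulOpposite.unop_op]
  · simp only [hFy, MulOpposite.unop_op]
  · intro σ τ
    simp only [map_mul, MulOpposite.unop_mul]
  · intro φ σ
    obtain ⟨i, j, s, t, hφx, hφy⟩ := aut_form h hmn φ
    have hE : F.comp φ.toMonoidHom =
        (MulEquiv.op (MulAut.conj φ)).toMonoidHom.comp F := by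
      apply hom_ext
      · change F (φ (genX p m n r)) =
          MulOpposite.op (MulAut.conj φ (F (genX p m n r)).unop)
        rw [hφx, map_mul, map_pow, map_pow, hFx, hFy, ← MulOpposite.op_pow, ← MulOpposite.op_pow,
          hηpow, MulOpposite.op_one, mul_one, MulOpposite.unop_op, MulAut.conj_apply, hξ,
          conj_aut_inv_pow, hφx, map_mul, map_pow, map_pow, conj_genY_pow_eq_one h, mul_one,
          ← pow_mul, ← inv_pow, ← pow_mul, mul_comm]
      · change F (φ (genY p m n r)) =
          MulOpposite.op (MulAut.conj φ (F (genY p m n r)).unop)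
        rw [hφy, map_mul, map_pow, map_pow, hFx, hFy, ← MulOpposite.op_pow, ← MulOpposite.op_pow,
          pow_succ η, hηpow, one_mul, MulOpposite.unop_op, MulAut.conj_apply,
          ← equivariant_genY h hx hy (by rw [hb, hA]) hb hφy, MulOpposite.op_mul]
    have hE' := DFunLike.congr_fun hE σ
    exact congrArg MulOpposite.unop hE'

end

/-! ### Residue classes and the exponents of α̃^a and δ̃^d -/

theorem cast_powMod {M N : ℕ} (hMN : M ∣ N) (z : ℤ) (hN : IsCoprime z (N : ℤ))
    (hM : IsCoprime z (M : ℤ)) (e : ℤ) :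
    ZMod.castHom hMN (ZMod M) (powMod N z hN e) = powMod M z hM e := by
  have h1 : ZMod.unitsMap hMN (ZMod.unitOfIsCoprime z hN) = ZMod.unitOfIsCoprime z hM := by
    ext
    simp [ZMod.unitsMap_def]
  have h2 := congrArg Units.val (congrArg (· ^ e) h1)
  simp only [← map_zpow] at h2
  exact h2

theorem cast_val_powMod {M N : ℕ} [NeZero N] (hMN : M ∣ N) (z : ℤ) (hN : IsCoprime z (N : ℤ))
    (hM : IsCoprime z (M : ℤ)) (e : ℤ) :
    ((powMod N z hN e).val : ZMod M) = powMod M z hM e := by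
  rw [← cast_powMod hMN z hN hM, ZMod.natCast_val, ZMod.castHom_apply]

theorem pow_val_intCast {G : Type*} [Group G] {g : G} {N : ℕ} [NeZero N] (hg : g ^ N = 1) (e : ℤ) :
    g ^ ((e : ZMod N)).val = g ^ e := by
  rw [← zpow_natCast, ZMod.val_intCast, ← Int.emod_add_mul_ediv e N, zpow_add, zpow_mul,
    zpow_natCast g N, hg, one_zpow, mul_one]
  simp

theorem zpow_apply_of_fixed {G : Type*} [Group G] {g : G} {f : MulAut G} (hf : f g = g) (a : ℤ) :
    (f ^ a) g = g :=
  Subgroup.zpow_mem (MulAction.stabilizer (MulAut G) g) (x := f) hf a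

theorem alphaTilde_zpow_genX [NeZero (p ^ m)] {u : ℤ}
    (hu : IsCoprime u ((p ^ m : ℕ) : ℤ)) (a : ℤ) :
    (alphaTilde p m n r u hu ^ a) (genX p m n r) =
      genX p m n r ^ (powMod (p ^ m) (uTilde p m r u) (uTilde_coprime hu) a).val := by
  refine zpow_apply_eq_pow genX_pow (U := ZMod.unitOfIsCoprime _ (uTilde_coprime hu)) ?_ a
  have h1 : alpha p m n r u hu (genX p m n r) =
      genX p m n r ^ (ZMod.unitOfIsCoprime u hu : ZMod (p ^ m)).val := by
    rw [alpha_x, ZMod.coe_unitOfIsCoprime, pow_val_intCast genX_pow]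
  have h2 := zpow_apply_eq_pow genX_pow h1 (((p - 1) * p ^ (m - r - 1) : ℕ) : ℤ)
  rw [zpow_natCast, zpow_natCast] at h2
  rw [alphaTilde, h2]
  simp [uTilde]

theorem deltaTilde_zpow_genY (h : Params p m n r) [NeZero (p ^ n)] (d : ℤ) :
    (deltaTilde h ^ d) (genY p m n r) =
      genY p m n r ^ (powMod (p ^ n) (vTilde p n r) (vTilde_coprime h n) d).val := by
  refine zpow_apply_eq_pow genY_pow (U := ZMod.unitOfIsCoprime _ (vTilde_coprime h n)) ?_ d
  have h1 : delta h (genY p m n r) =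
      genY p m n r ^ (ZMod.unitOfIsCoprime _ (h.coprime n) : ZMod (p ^ n)).val := by
    rw [delta_y, ZMod.coe_unitOfIsCoprime, pow_val_intCast genY_pow, ← zpow_natCast]
    push_cast
    rfl
  have h2 := zpow_apply_eq_pow genY_pow h1 ((p ^ (n - 2 * r) : ℕ) : ℤ)
  rw [zpow_natCast, zpow_natCast] at h2
  rw [deltaTilde, h2]
  simp [vTilde]

theorem deltaTilde_zpow_genX (h : Params p m n r) (d : ℤ) :
    (deltaTilde h ^ d) (genX p m n r) = genX p m n r := by
  apply zpow_apply_of_fixed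
  have := zpow_apply_of_fixed (delta_x h) ((p ^ (n - 2 * r) : ℕ) : ℤ)
  rwa [zpow_natCast] at this

theorem alphaTilde_zpow_genY {u : ℤ} (hu : IsCoprime u ((p ^ m : ℕ) : ℤ)) (a : ℤ) :
    (alphaTilde p m n r u hu ^ a) (genY p m n r) = genY p m n r := by
  apply zpow_apply_of_fixed
  have := zpow_apply_of_fixed (alpha_y (n := n) (r := r) u hu) (((p - 1) * p ^ (m - r - 1) : ℕ) : ℤ)
  rwa [zpow_natCast] at this

/-- The exponent defining ũ, multiplied by p^r, is Euler's φ(p^m). Together with the analogue for ṽ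
this yields η^(p^r) = 1. -/
theorem unit_uTilde_pow (h : Params p m n r) {u : ℤ} (hu : IsCoprime u ((p ^ m : ℕ) : ℤ)) :
    ZMod.unitOfIsCoprime _ (uTilde_coprime (r := r) hu) ^ (p ^ r) = 1 := by
  have h1 : ZMod.unitOfIsCoprime _ (uTilde_coprime (r := r) hu) =
      ZMod.unitOfIsCoprime u hu ^ ((p - 1) * p ^ (m - r - 1)) := by
    ext
    simp [uTilde]
  have hr := h.r_lt_m
  have h2 : (p - 1) * p ^ (m - r - 1) * p ^ r = Nat.totient (p ^ m) := by
    rw [Nat.totient_prime_pow h.prime (by omega), mul_assoc, ← pow_add, mul_comm]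
    congr 2
    omega
  rw [h1, ← pow_mul, h2, ZMod.pow_totient]

theorem unit_vTilde_pow (h : Params p m n r) :
    ZMod.unitOfIsCoprime _ (vTilde_coprime h n) ^ (p ^ r) = 1 := by
  ext
  rw [Units.val_pow_eq_pow_val, ZMod.coe_unitOfIsCoprime, Units.val_one, ← Int.cast_pow,
    ← Int.cast_one, ZMod.intCast_eq_intCast_iff_dvd_sub, ← dvd_neg, neg_sub, vTilde, ← pow_mul,
    ← pow_add, ← mul_geom_sum, add_sub_cancel_left]
  have hp : (p : ℤ) ^ r ≠ 0 := pow_ne_zero _ (by exact_mod_cast h.prime.ne_zero)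
  have h1 := pow_dvd_geom_sum (p := p) (w := 1 + (p : ℤ) ^ r)
    (by simpa using dvd_pow_self (p : ℤ) (show r ≠ 0 by have := h.one_le_r; omega))
    (by simpa using hp) (n - 2 * r + r)
  refine dvd_trans ?_ (mul_dvd_mul_left ((p : ℤ) ^ r) h1)
  rw [← pow_add, Nat.cast_pow]
  exact pow_dvd_pow _ (by omega)

/-- ṽ is a power of 1+p^r, hence 1 modulo p^r; this is the form of exponent for which powers act
coordinatewise. -/
theorem exists_powMod_vTilde_val (h : Params p m n r) [NeZero (p ^ n)] (d : ℤ) :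
    ∃ w, (powMod (p ^ n) (vTilde p n r) (vTilde_coprime h n) d).val = p ^ r * w + 1 := by
  have h1 := cast_val_powMod (pow_dvd_pow p h.r_le_n) _ (vTilde_coprime h n) (vTilde_coprime h r) d
  have h2 : ZMod.unitOfIsCoprime _ (vTilde_coprime h r) = 1 := by
    have : (p : ZMod (p ^ r)) ^ r = 0 := cast_pow_m
    ext
    simp [vTilde, this]
  rw [powMod.eq_def (p ^ r), h2, one_zpow, Units.val_one, ← Nat.cast_one,
    ZMod.natCast_eq_natCast_iff'] at h1
  have hr : 1 < p ^ r := Nat.one_lt_pow (by have := h.one_le_r; omega) h.prime.one_lt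
  rw [Nat.mod_eq_of_lt hr] at h1
  refine ⟨(powMod (p ^ n) (vTilde p n r) (vTilde_coprime h n) d).val / p ^ r, ?_⟩
  conv_lhs => rw [← Nat.div_add_mod (powMod (p ^ n) (vTilde p n r) (vTilde_coprime h n) d).val (p ^ r), h1]

theorem betaTilde_zpow (h : Params p m n r) [NeZero (p ^ m)] (b : ℤ) :
    betaTilde h ^ b = (MulAut.conj (genX p m n r))⁻¹ ^ ((b : ZMod (p ^ m))).val := by
  rw [betaTilde_eq, pow_val_intCast]
  rw [inv_pow, ← map_pow, genX_pow, map_one, inv_one]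

theorem cast_mul_sub_one_eq_zero_iff (h : Params p m n r) (b : ℤ) :
    (b : ZMod (p ^ m)) * (b - 1) * (p ^ (m - r) * p ^ (m - r)) = 0 ↔
      (b ≡ 0 [ZMOD (p : ℤ) ^ (2 * r - m)] ∨ b ≡ 1 [ZMOD (p : ℤ) ^ (2 * r - m)]) := by
  have hr := h.r_lt_m
  have hp0 : (p : ℤ) ≠ 0 := by exact_mod_cast h.prime.ne_zero
  have h1 : (b : ZMod (p ^ m)) * (b - 1) * (p ^ (m - r) * p ^ (m - r)) =
      ((b * (b - 1) * ((p : ℤ) ^ (m - r) * (p : ℤ) ^ (m - r)) : ℤ) : ZMod (p ^ m)) := by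
    push_cast; rfl
  have h2 : b ≡ 1 [ZMOD (p : ℤ) ^ (2 * r - m)] ↔ (p : ℤ) ^ (2 * r - m) ∣ b - 1 :=
    ⟨fun hb => hb.symm.dvd, fun hb => (Int.modEq_iff_dvd.mpr hb).symm⟩
  rw [h1, ZMod.intCast_zmod_eq_zero_iff_dvd, Int.modEq_zero_iff_dvd, h2, Nat.cast_pow]
  have hprime : Prime (p : ℤ) := Nat.prime_iff_prime_int.mp h.prime
  constructor
  · intro hd
    have h3 : (p : ℤ) ^ (2 * r - m) ∣ b * (b - 1) := by
      rcases le_total (2 * r) m with hm | hm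
      · rw [Nat.sub_eq_zero_of_le hm, pow_zero]; exact one_dvd _
      · have h4 : (p : ℤ) ^ m = (p : ℤ) ^ (2 * r - m) * ((p : ℤ) ^ (m - r) * (p : ℤ) ^ (m - r)) := by
          rw [← pow_add, ← pow_add]; congr 1; omega
        rw [h4] at hd
        exact Int.dvd_of_mul_dvd_mul_right (by positivity) hd
    -- p cannot divide both b and b-1, so the whole prime power divides one of them.
    by_cases hb : (p : ℤ) ∣ b
    · left
      refine hprime.pow_dvd_of_dvd_mul_right _ (fun hb' => ?_) h3
      have := dvd_sub hb hb'
      rw [sub_sub_cancel] at this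
      exact hprime.not_dvd_one this
    · right
      exact hprime.pow_dvd_of_dvd_mul_left _ hb h3
  · intro hd
    have h3 : (p : ℤ) ^ (2 * r - m) ∣ b * (b - 1) := by
      rcases hd with hd | hd
      · exact hd.mul_right _
      · exact hd.mul_left _
    refine dvd_trans ?_ (mul_dvd_mul_right h3 _)
    rw [← pow_add, ← pow_add]
    exact pow_dvd_pow _ (by omega)

theorem one_add_pow_val (h : Params p m n r) [NeZero (p ^ m)] {b : ℤ}
    (hb : b ≡ 0 [ZMOD (p : ℤ) ^ (2 * r - m)] ∨ b ≡ 1 [ZMOD (p : ℤ) ^ (2 * r - m)]) :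
    (1 + (p : ZMod (p ^ m)) ^ (m - r)) ^ ((b : ZMod (p ^ m))).val = 1 + b * p ^ (m - r) := by
  have hr := h.r_lt_m
  set b₀ := ((b : ZMod (p ^ m))).val with hb₀
  have h1 : ((b₀ : ℤ) : ZMod (p ^ m)) = b := by rw [hb₀]; simp
  -- Reducing b modulo p^m preserves its class modulo p^max{2r-m,0}, since that exponent is at most
  -- m.
  have h2 : (b₀ : ℤ) ≡ b [ZMOD (p : ℤ) ^ (2 * r - m)] := by
    rw [ZMod.intCast_eq_intCast_iff] at h1
    exact h1.of_dvd (by push_cast; exact pow_dvd_pow _ (by omega))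
  rw [one_add_pow_eq_linear h, ← Int.cast_natCast b₀, h1]
  rcases Nat.eq_zero_or_pos b₀ with h0 | h0
  · left; rw [h0]; exact dvd_zero _
  rcases hb with hb | hb
  · left
    have := Int.modEq_zero_iff_dvd.mp (h2.trans hb)
    exact_mod_cast this
  · right
    refine ⟨h0, ?_⟩
    have := (h2.trans hb).symm.dvd
    rw [← Nat.cast_one, ← Nat.cast_sub h0] at this
    exact_mod_cast this

end SplitMetacyclic

/-! ### Assembly of the two cases -/

open SplitMetacyclic in
theorem mainTheorem3 (p m n r : ℕ) (h : SplitMetacyclic.Params p m n r)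
    (u : ℤ) (hu : IsCoprime u ((p ^ m : ℕ) : ℤ))
    (hgen : Subgroup.zpowers (ZMod.unitOfIsCoprime u hu) = ⊤)
    (a b d : ℤ) :
    (m ≤ n →
      (SplitMetacyclic.Admissible h u hu a b d ↔
        SplitMetacyclic.powMod (p ^ m) (SplitMetacyclic.uTilde p m r u)
              (SplitMetacyclic.uTilde_coprime hu) (-a) *
            SplitMetacyclic.powMod (p ^ m) (SplitMetacyclic.vTilde p n r)
              (SplitMetacyclic.vTilde_coprime h m) d =
          ((1 + b * (p : ℤ) ^ (m - r) : ℤ) : ZMod (p ^ m)) ∧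
        (b ≡ 0 [ZMOD (p : ℤ) ^ (2 * r - m)] ∨ b ≡ 1 [ZMOD (p : ℤ) ^ (2 * r - m)]))) ∧
    (n ≤ m - r →
      (SplitMetacyclic.Admissible h u hu a b d ↔
        SplitMetacyclic.powMod (p ^ m) (SplitMetacyclic.uTilde p m r u)
              (SplitMetacyclic.uTilde_coprime hu) a *
            ((1 + b * (p : ℤ) ^ (m - r) : ℤ) : ZMod (p ^ m)) = 1 ∧
        SplitMetacyclic.powMod (p ^ n) (SplitMetacyclic.vTilde p n r)
              (SplitMetacyclic.vTilde_coprime h n) d = 1)) := by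
  have hm0 : NeZero (p ^ m) := ⟨pow_ne_zero _ h.prime.ne_zero⟩
  have hn0 : NeZero (p ^ n) := ⟨pow_ne_zero _ h.prime.ne_zero⟩
  set η := alphaTilde p m n r u hu ^ a * deltaTilde h ^ d with hη
  have hx : η (genX p m n r) = genX p m n r ^
      (powMod (p ^ m) (uTilde p m r u) (uTilde_coprime hu) a).val := by
    rw [hη, MulAut.mul_apply, deltaTilde_zpow_genX, alphaTilde_zpow_genX]
  have hy : η (genY p m n r) = genY p m n r ^
      (powMod (p ^ n) (vTilde p n r) (vTilde_coprime h n) d).val := by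
    rw [hη, MulAut.mul_apply, deltaTilde_zpow_genY, map_pow, alphaTilde_zpow_genY]
  have hηp : η ^ (p ^ r) = 1 := by
    apply aut_ext
    · have h1 := zpow_apply_eq_pow genX_pow hx ((p ^ r : ℕ) : ℤ)
      rw [← zpow_mul, mul_comm, zpow_mul, zpow_natCast, zpow_natCast, unit_uTilde_pow h hu, one_zpow] at h1
      rw [h1, pow_congr genX_pow (b := 1) (by simp), pow_one]
      rfl
    · have h1 := zpow_apply_eq_pow genY_pow hy ((p ^ r : ℕ) : ℤ)
      rw [← zpow_mul, mul_comm, zpow_mul, zpow_natCast, zpow_natCast, unit_vTilde_pow h, one_zpow] at h1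
      rw [h1, pow_congr genY_pow (b := 1) (by simp), pow_one]
      rfl
  set b₀ := ((b : ZMod (p ^ m))).val with hb₀
  have hb₀c : (b₀ : ZMod (p ^ m)) = b := by rw [hb₀]; simp
  have hAdm : Admissible h u hu a b d ↔ ∃ Γ : Grp p m n r → MulAut (Grp p m n r),
      Γ (genX p m n r) = (MulAut.conj (genX p m n r))⁻¹ ^ b₀ ∧ Γ (genY p m n r) = η ∧
      IsAntihom Γ ∧ IsAutEquivariant Γ := by
    rw [Admissible, betaTilde_zpow]
  have hAc : ((powMod (p ^ m) (uTilde p m r u) (uTilde_coprime hu) a).val : ZMod (p ^ m)) =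
      powMod (p ^ m) (uTilde p m r u) (uTilde_coprime hu) a := by simp
  rw [hAdm]
  constructor
  · intro hmn
    have hiff : powMod (p ^ m) (uTilde p m r u) (uTilde_coprime hu) (-a) *
          powMod (p ^ m) (vTilde p n r) (vTilde_coprime h m) d =
          ((1 + b * (p : ℤ) ^ (m - r) : ℤ) : ZMod (p ^ m)) ↔
        ((powMod (p ^ m) (uTilde p m r u) (uTilde_coprime hu) a).val : ZMod (p ^ m)) *
          (1 + b₀ * p ^ (m - r)) =
          ((powMod (p ^ n) (vTilde p n r) (vTilde_coprime h n) d).val : ZMod (p ^ m)) := by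
      -- The exponent of y is defined modulo p^n; m ≤ n allows its reduction modulo p^m.
      rw [cast_val_powMod (pow_dvd_pow p hmn) _ _ (vTilde_coprime h m), hAc, hb₀c]
      rw [powMod.eq_def _ _ _ (-a), zpow_neg, Units.inv_mul_eq_iff_eq_mul, eq_comm]
      push_cast
      rfl
    obtain ⟨w, hw⟩ := exists_powMod_vTilde_val h d
    rw [hiff, ← cast_mul_sub_one_eq_zero_iff h]
    rw [hw] at hy ⊢
    constructor
    · rintro ⟨Γ, h1, h2, h3, h4⟩
      rw [← hb₀c]
      exact eq_of_equivariant_of_le h hmn hx hy (by rw [hAc]; exact Units.isUnit _) h1 h2 h3 h4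
    · rintro ⟨h1, h2⟩
      have h3 := one_add_pow_val h ((cast_mul_sub_one_eq_zero_iff h b).mp h2)
      rw [← hb₀c] at h2
      exact exists_equivariant_of_le h hmn hx hy hηp h1 (by rw [h3, hb₀c]) h2
  · intro hn
    -- Here 2r ≤ m, so the modulus p^max{2r-m,0} is 1 and (1+q)^b = 1+bq holds for every b.
    have hK := one_add_pow_val h (b := b) (by
      rw [Nat.sub_eq_zero_of_le (by have := h.r_le_n; omega), pow_zero]
      left; exact Int.modEq_one)
    have hiff : powMod (p ^ m) (uTilde p m r u) (uTilde_coprime hu) a *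
          ((1 + b * (p : ℤ) ^ (m - r) : ℤ) : ZMod (p ^ m)) = 1 ↔
        ((powMod (p ^ m) (uTilde p m r u) (uTilde_coprime hu) a).val : ZMod (p ^ m)) *
          (1 + p ^ (m - r)) ^ b₀ = 1 := by
      rw [hAc, hK]
      push_cast
      rfl
    have hVc : ((powMod (p ^ n) (vTilde p n r) (vTilde_coprime h n) d).val : ZMod (p ^ n)) =
      powMod (p ^ n) (vTilde p n r) (vTilde_coprime h n) d := by simp
    rw [hiff, ← hVc]
    constructor
    · rintro ⟨Γ, h1, h2, h3, h4⟩
      exact eq_of_equivariant_of_le_sub h hn hx hy h1 h2 h3 h4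
    · rintro ⟨h1, h2⟩
      exact exists_equivariant_of_le_sub h hn hx hy h1 h2
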